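/- Let $T\in(0,\infty]$, let $z=x+iy:[0,T)\to\{\Im z>0\}$ and $f:[0,T)\to(0,\infty)$, and set $$R=\frac{f}{y}\begin{pmatrix}1&-x\\-x&x^2+y^2\end{pmatrix},\qquad J=\begin{pmatrix}0&-1\\1&0\end{pmatrix},\qquad \tau v=R^{-1}Jv'.$$ Assume that (A) $R(t)$ is positive definite for all $t\in[0,T)$; (B) $R$ is measurable and $\|R\|$, $\|R^{-1}\|$ are locally bounded on $[0,T)$; (C) there is a nonzero $u_*\in\mathbb R^2$ with $\int_0^T u_*^tR(s)u_*\,ds<\infty$. The operator is called limit circle (at $T$) if $\|R\|$ is integrable on $[0,T)$ and limit point otherwise. Let $u_0,u_1\in\mathbb R^2$ be non-parallel vectors, where in the limit point case $u_1$ satisfies $\int_0^T u_1^tR(s)u_1\,ds<\infty$. Let $L^2_R$ be the (real or complex) Hilbert space of measurable $v$ on $[0,T)$ with values in $\mathbb R^2$ or $\mathbb C^2$ and $\int_0^T v^*Rv\,dt<\infty$. The domain of $\tau$ consists of the $v\in L^2_R$ that are (locally) absolutely continuous on $[0,T)$, with $\tau v\in L^2_R$, $v(0)^tJu_0=0$ and,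 in the limit circle case, also $\lim_{s\to T}v(s)^tJu_1=0$. Assume that $\tau$ is a bijection of its domain onto $L^2_R$ whose inverse is Hilbert–Schmidt. Let $\varphi_0,\varphi_1\in[0,2\pi)$ be such that $u_i\parallel(\cos(\varphi_i/2),-\sin(\varphi_i/2))^t$. For $\lambda\in\mathbb R$ let $v(\cdot,\lambda)$ be the absolutely continuous solution of $\tau v=\lambda v$ on $[0,T)$ with $v(0,\lambda)=(\cos(\varphi_0/2),-\sin(\varphi_0/2))^t$, and let the phase function $\phi_\lambda:[0,T)\to\mathbb R$ be the continuous function with $\phi_\lambda(0)=\varphi_0$ and $$v_1(t,\lambda)-i\,v_2(t,\lambda)=r(t,\lambda)\,e^{i\phi_\lambda(t)/2},\qquad r(t,\lambda)>0 .$$ Then for every $\lambda\in\mathbb R$ the limit $\phi_\lambda(T)=\lim_{t\uparrow T}\phi_\lambda(t)$ exists and is finite. In the limit circle case the function $\lambda\mapsto\phi_\lambda(T)$ is continuous and strictly increasing on $\mathbb R$, and $$\{\text{eigenvalues of }\tau\}=\{\lambda\in\mathbb R:\ \phi_\lambda(T)\in\varphi_1+2\pi\mathbb Z\}.$$ In the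 limit point case $\phi_\lambda(T)\in\varphi_1+2\pi\mathbb Z$ for all real $\lambda\neq0$. -/

import Mathlib

open MeasureTheory Filter Topology

namespace Dirac

/-- The half-open interval `[0, T)`, where `T` may be `+∞`. -/
def dom (T : EReal) : Set ℝ := {t : ℝ | 0 ≤ t ∧ (t : EReal) < T}

/-- The filter `t ↑ T`, where `T` may be `+∞`. -/
noncomputable def leftOf (T : EReal) : Filter ℝ := comap (fun t : ℝ => (t : EReal)) (𝓝[<] T)

/-- Lebesgue measure on `[0, T)`. -/
noncomputable def vol (T : EReal) : Measure ℝ := volume.restrict (dom T)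

/-- The matrix `J`, with entries in a commutative ring. -/
def J (A : Type*) [CommRing A] : Matrix (Fin 2) (Fin 2) A := !![0, -1; 1, 0]

/-- The vector `(cos (φ/2), -sin (φ/2))`. -/
noncomputable def angleVec (φ : ℝ) : Fin 2 → ℝ := ![Real.cos (φ / 2), -Real.sin (φ / 2)]

/-- Two vectors of the plane are parallel when their Wronskian `aᵗ J b` vanishes. -/
def Parallel (a b : Fin 2 → ℝ) : Prop := a ⬝ᵥ (J ℝ).mulVec b = 0

/-- The weight `R = (f / y) [[1, -x], [-x, x² + y²]]` attached to a path `z = x + i y` in the upper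
half plane and a function `f`. -/
noncomputable def weight (z : ℝ → UpperHalfPlane) (f : ℝ → ℝ) (t : ℝ) :
    Matrix (Fin 2) (Fin 2) ℝ :=
  (f t / (z t).im) • !![1, -(z t).re; -(z t).re, (z t).re ^ 2 + (z t).im ^ 2]

/-- The constant function `u` has finite norm: `∫₀ᵀ uᵗ R(s) u ds < ∞`. -/
def ConstMemL2 (R : ℝ → Matrix (Fin 2) (Fin 2) ℝ) (T : EReal) (u : Fin 2 → ℝ) : Prop :=
  Integrable (fun s => u ⬝ᵥ (R s).mulVec u) (vol T)

/-- The standing assumptions (A), (B), (C) on the weight `R` on `[0, T)`. -/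
structure Admissible (R : ℝ → Matrix (Fin 2) (Fin 2) ℝ) (T : EReal) : Prop where
  posDef : ∀ t ∈ dom T, (R t).PosDef
  measurable : ∀ i j, AEStronglyMeasurable (fun t => R t i j) (vol T)
  bounded : ∀ b ∈ dom T, ∃ C : ℝ, ∀ t ∈ Set.Icc 0 b, ∀ i j, |R t i j| ≤ C
  inv_bounded : ∀ b ∈ dom T, ∃ C : ℝ, ∀ t ∈ Set.Icc 0 b, ∀ i j, |(R t)⁻¹ i j| ≤ C
  exists_const : ∃ u : Fin 2 → ℝ, u ≠ 0 ∧ ConstMemL2 R T u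

/-- Limit circle at `T`: `‖R‖` is integrable on `[0, T)`. -/
def LimitCircle (R : ℝ → Matrix (Fin 2) (Fin 2) ℝ) (T : EReal) : Prop :=
  ∀ i j, Integrable (fun t => R t i j) (vol T)

/-- Limit point at `T`: `‖R‖` is not integrable on `[0, T)`. -/
def LimitPoint (R : ℝ → Matrix (Fin 2) (Fin 2) ℝ) (T : EReal) : Prop := ¬ LimitCircle R T

section operator

variable {𝕜 : Type*} [RCLike 𝕜]

/-- The integrand `v(t)* R(t) w(t)` of the inner product of `L²_R`. -/
noncomputable def pairing (R : ℝ → Matrix (Fin 2) (Fin 2) ℝ) (v w : ℝ → Fin 2 → 𝕜) (t : ℝ) : 𝕜 :=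
  star (v t) ⬝ᵥ ((R t).map (RCLike.ofReal : ℝ → 𝕜)).mulVec (w t)

/-- The function `v` belongs to `L²_R[0, T)`. -/
def MemL2 (R : ℝ → Matrix (Fin 2) (Fin 2) ℝ) (T : EReal) (v : ℝ → Fin 2 → 𝕜) : Prop :=
  AEStronglyMeasurable v (vol T) ∧ Integrable (pairing R v v) (vol T)

/-- The inner product `⟨v, w⟩_R` of `L²_R[0, T)`. -/
noncomputable def innerL2 (R : ℝ → Matrix (Fin 2) (Fin 2) ℝ) (T : EReal)
    (v w : ℝ → Fin 2 → 𝕜) : 𝕜 := ∫ t, pairing R v w t ∂(vol T)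

/-- `v` is (locally) absolutely continuous on `[0, T)`. -/
def IsAC (T : EReal) (v : ℝ → Fin 2 → 𝕜) : Prop :=
  ∃ g : ℝ → Fin 2 → 𝕜, ∀ t ∈ dom T,
    IntervalIntegrable g volume 0 t ∧ v t = v 0 + ∫ s in (0 : ℝ)..t, g s

/-- The differential expression `τ v = R⁻¹ J v'`, meaningful almost everywhere on `[0, T)` when `v`
is absolutely continuous. -/
noncomputable def tau (R : ℝ → Matrix (Fin 2) (Fin 2) ℝ) (v : ℝ → Fin 2 → 𝕜) (t : ℝ) : Fin 2 → 𝕜 :=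
  (((R t)⁻¹).map (RCLike.ofReal : ℝ → 𝕜)).mulVec ((J 𝕜).mulVec (deriv v t))

/-- The Wronskian `vᵗ J u` of a vector `v` with a real vector `u`. -/
noncomputable def wronskian (v : Fin 2 → 𝕜) (u : Fin 2 → ℝ) : 𝕜 :=
  v ⬝ᵥ (J 𝕜).mulVec (fun i => (u i : 𝕜))

/-- The domain of the Dirac operator with boundary conditions `u₀`, `u₁`; the condition at the
right endpoint is imposed in the limit circle case only. -/
structure MemDomain (R : ℝ → Matrix (Fin 2) (Fin 2) ℝ) (T : EReal) (u₀ u₁ : Fin 2 → ℝ)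
    (v : ℝ → Fin 2 → 𝕜) : Prop where
  memL2 : MemL2 R T v
  isAC : IsAC T v
  tau_memL2 : MemL2 R T (tau R v)
  left_bc : wronskian (v 0) u₀ = 0
  right_bc : LimitCircle R T → Tendsto (fun s => wronskian (v s) u₁) (leftOf T) (𝓝 0)

/-- `μ` is an eigenvalue of the Dirac operator. -/
def IsEigenvalue (R : ℝ → Matrix (Fin 2) (Fin 2) ℝ) (T : EReal) (u₀ u₁ : Fin 2 → ℝ)
    (μ : 𝕜) : Prop :=
  ∃ v : ℝ → Fin 2 → 𝕜, MemDomain R T u₀ u₁ v ∧ (∃ t ∈ dom T, v t ≠ 0) ∧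
    tau R v =ᵐ[vol T] fun t => μ • v t

/-- `v` solves `τ v = lam v` on `[0, T)` with `v(0) = a`. -/
structure IsSolution (R : ℝ → Matrix (Fin 2) (Fin 2) ℝ) (T : EReal) (lam : 𝕜) (a : Fin 2 → 𝕜)
    (v : ℝ → Fin 2 → 𝕜) : Prop where
  isAC : IsAC T v
  eqn : tau R v =ᵐ[vol T] fun t => lam • v t
  init : v 0 = a

end operator

/-- The Dirac operator maps its domain bijectively onto `L²_R` and its inverse is Hilbert-Schmidt:
the sums `∑ ‖τ⁻¹ wₖ‖²` over finite orthonormal families `(wₖ)` in `L²_R` are bounded by a constant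
(the least such constant is the sum of `‖τ⁻¹ eₖ‖²` over any orthonormal basis). -/
def HasHilbertSchmidtInverse (𝕜 : Type*) [RCLike 𝕜] (R : ℝ → Matrix (Fin 2) (Fin 2) ℝ)
    (T : EReal) (u₀ u₁ : Fin 2 → ℝ) : Prop :=
  (∀ w : ℝ → Fin 2 → 𝕜, MemL2 R T w →
    ∃ v : ℝ → Fin 2 → 𝕜, (MemDomain R T u₀ u₁ v ∧ tau R v =ᵐ[vol T] w) ∧
      ∀ v' : ℝ → Fin 2 → 𝕜, MemDomain R T u₀ u₁ v' → tau R v' =ᵐ[vol T] w →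
        Set.EqOn v' v (dom T)) ∧
  ∃ C : ℝ, ∀ (n : ℕ) (w v : Fin n → ℝ → Fin 2 → 𝕜),
    (∀ k, MemL2 R T (w k)) →
    (∀ k l, innerL2 R T (w k) (w l) = if k = l then 1 else 0) →
    (∀ k, MemDomain R T u₀ u₁ (v k) ∧ tau R (v k) =ᵐ[vol T] w k) →
    ∑ k, RCLike.re (innerL2 R T (v k) (v k)) ≤ C

/-- `φ` is the phase function with initial angle `φ₀` and spectral parameter `lam`: the continuous
function with `(1, -i) · v(t) = r(t) e^{i φ(t) / 2}`, `r(t) > 0`, `φ(0) = φ₀`, where `v` solves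
`τ v = lam v` with `v(0) = (cos (φ₀/2), -sin (φ₀/2))`. -/
def IsPhaseFunction (R : ℝ → Matrix (Fin 2) (Fin 2) ℝ) (T : EReal) (φ₀ lam : ℝ)
    (φ : ℝ → ℝ) : Prop :=
  ContinuousOn φ (dom T) ∧ φ 0 = φ₀ ∧
  ∃ v : ℝ → Fin 2 → ℝ, IsSolution R T lam (angleVec φ₀) v ∧
    ∃ r : ℝ → ℝ, ∀ t ∈ dom T, 0 < r t ∧
      (v t 0 : ℂ) - Complex.I * (v t 1 : ℂ) =
        (r t : ℂ) * Complex.exp (Complex.I * ((φ t / 2 : ℝ) : ℂ))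

end Dirac

namespace Dirac

section Domain

variable {T : EReal}

theorem zero_mem_dom (hT : 0 < T) : (0 : ℝ) ∈ dom T := ⟨le_rfl, by simpa using hT⟩

theorem mem_dom_of_le {s t : ℝ} (hs : 0 ≤ s) (hst : s ≤ t) (ht : t ∈ dom T) : s ∈ dom T :=
  ⟨hs, lt_of_le_of_lt (by exact_mod_cast hst) ht.2⟩

theorem Icc_subset_dom {s t : ℝ} (hs : 0 ≤ s) (ht : t ∈ dom T) : Set.Icc s t ⊆ dom T :=
  fun _ hx => mem_dom_of_le (hs.trans hx.1) hx.2 ht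

theorem ordConnected_dom : (dom T).OrdConnected :=
  ⟨fun _ hx _ hy => Icc_subset_dom hx.1 hy⟩

theorem measurableSet_dom : MeasurableSet (dom T) :=
  (ordConnected_dom).measurableSet

theorem eventually_leftOf {b : ℝ} (hb : b ∈ dom T) : ∀ᶠ t in leftOf T, b < t ∧ t ∈ dom T := by
  have h : Set.Ioo (b : EReal) T ∈ 𝓝[<] T := Ioo_mem_nhdsLT hb.2
  filter_upwards [preimage_mem_comap h] with t ht
  have h1 : b < t := EReal.coe_lt_coe_iff.1 ht.1
  exact ⟨h1, hb.1.trans h1.le, ht.2⟩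

theorem exists_of_eventually_leftOf (hT : 0 < T) {P : ℝ → Prop} (h : ∀ᶠ t in leftOf T, P t) :
    ∃ b ∈ dom T, ∀ t ∈ dom T, b < t → P t := by
  obtain ⟨s, hs, hsub⟩ := mem_comap.1 h
  obtain ⟨l, hl, hls⟩ := (mem_nhdsLT_iff_exists_Ioo_subset' hT).1 hs
  obtain ⟨q, h1, h2⟩ := EReal.lt_iff_exists_rat_btwn.1 (max_lt hl hT)
  have h0 : (0 : ℝ) < q := by
    have := (le_max_right l 0).trans_lt h1
    exact_mod_cast this
  refine ⟨q, ⟨h0.le, h2⟩, fun t ht hqt => hsub (hls ⟨?_, ht.2⟩)⟩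
  exact ((le_max_left l 0).trans_lt h1).trans (EReal.coe_lt_coe_iff.2 hqt)

theorem leftOf_neBot (hT : 0 < T) : (leftOf T).NeBot := by
  refine comap_neBot_iff.2 fun s hs => ?_
  have : (𝓝[<] T).NeBot := nhdsLT_neBot_of_exists_lt ⟨0, hT⟩
  obtain ⟨x, hxs, hx⟩ := Filter.nonempty_of_mem (inter_mem hs (Ioo_mem_nhdsLT hT))
  refine ⟨x.toReal, ?_⟩
  rwa [EReal.coe_toReal (hx.2.trans_le le_top).ne ((bot_le.trans_lt hx.1).ne')]

instance : (leftOf T).IsCountablyGenerated := by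
  unfold leftOf; infer_instance

theorem exists_gt_mem_dom {t : ℝ} (ht : t ∈ dom T) : ∃ q : ℚ, t < q ∧ (q : ℝ) ∈ dom T := by
  obtain ⟨q, h1, h2⟩ := EReal.lt_iff_exists_rat_btwn.1 ht.2
  have h1' : t < q := by exact_mod_cast h1
  exact ⟨q, h1', ht.1.trans h1'.le, h2⟩

theorem ae_vol_of_forall_Icc {P : ℝ → Prop}
    (h : ∀ b ∈ dom T, ∀ᵐ t, t ∈ Set.Icc 0 b → P t) : ∀ᵐ t ∂(vol T), P t := by
  rw [vol, ae_restrict_iff' measurableSet_dom]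
  have h' : ∀ᵐ t, ∀ q : ℚ, (q : ℝ) ∈ dom T → t ∈ Set.Icc 0 (q : ℝ) → P t := by
    rw [ae_all_iff]
    intro q
    by_cases hq : (q : ℝ) ∈ dom T
    · filter_upwards [h q hq] with t ht _ using ht
    · exact Eventually.of_forall fun t h => absurd h hq
  filter_upwards [h'] with t ht htd
  obtain ⟨q, h1, h2⟩ := exists_gt_mem_dom htd
  exact ht q h2 ⟨htd.1, h1.le⟩

theorem ae_Icc_of_ae_vol {P : ℝ → Prop} (h : ∀ᵐ t ∂(vol T), P t) {b : ℝ} (hb : b ∈ dom T) :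
    ∀ᵐ t, t ∈ Set.Icc 0 b → P t := by
  rw [vol, ae_restrict_iff' measurableSet_dom] at h
  filter_upwards [h] with t ht h2 using ht (Icc_subset_dom le_rfl hb h2)

theorem aecover_leftOf :
    AECover (vol T) (leftOf T) (fun t => {x | x ∈ Set.Icc 0 t ∧ t ∈ dom T}) where
  ae_eventually_mem := by
    filter_upwards [ae_restrict_mem measurableSet_dom] with x hx
    filter_upwards [eventually_leftOf hx] with t ht using ⟨⟨hx.1, ht.1.le⟩, ht.2⟩
  measurableSet t := measurableSet_Icc.inter (MeasurableSet.const _)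

theorem integrable_vol_of_bounded (hT : 0 < T) {f : ℝ → ℝ} (h0 : ∀ t ∈ dom T, 0 ≤ f t)
    (hf : ∀ t ∈ dom T, IntervalIntegrable f volume 0 t) {C : ℝ}
    (hC : ∀ t ∈ dom T, ∫ s in (0 : ℝ)..t, f s ≤ C) : Integrable f (vol T) := by
  have := leftOf_neBot hT
  have hset : ∀ t ∈ dom T, (vol T).restrict {x | x ∈ Set.Icc 0 t ∧ t ∈ dom T} =
      volume.restrict (Set.Icc 0 t) := fun t ht => by
    have hm : MeasurableSet {x | x ∈ Set.Icc 0 t ∧ t ∈ dom T} :=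
      measurableSet_Icc.inter (MeasurableSet.const _)
    rw [vol, Measure.restrict_restrict hm]
    congr 1
    ext x
    exact ⟨fun h => h.1.1, fun h => ⟨⟨h, ht⟩, Icc_subset_dom le_rfl ht h⟩⟩
  refine aecover_leftOf.integrable_of_integral_bounded_of_nonneg_ae C (fun t => ?_)
    ((ae_restrict_iff' measurableSet_dom).2 (Eventually.of_forall h0)) ?_
  · by_cases ht : t ∈ dom T
    · rw [IntegrableOn, hset t ht]
      exact (integrableOn_Icc_iff_integrableOn_Ioc).2 (hf t ht).1
    · simp [ht]
  · filter_upwards [eventually_leftOf (zero_mem_dom hT)] with t ht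
    rw [hset t ht.2, integral_Icc_eq_integral_Ioc, ← intervalIntegral.integral_of_le ht.2.1]
    exact hC t ht.2

theorem integrable_vol_of_tail {f g : ℝ → ℝ} {b : ℝ} (hb : b ∈ dom T)
    (hm : AEStronglyMeasurable f (vol T)) (hf : IntervalIntegrable f volume 0 b)
    (hg : Integrable g (vol T)) (hfg : ∀ t ∈ dom T, b < t → |f t| ≤ g t) :
    Integrable f (vol T) := by
  have hunion : dom T = Set.Icc 0 b ∪ (dom T ∩ Set.Ioi b) := by
    ext x
    refine ⟨fun hx => ?_, ?_⟩
    · rcases le_or_gt x b with h | h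
      · exact Or.inl ⟨hx.1, h⟩
      · exact Or.inr ⟨hx, h⟩
    · rintro (h | h)
      · exact Icc_subset_dom le_rfl hb h
      · exact h.1
  have hsub : dom T ∩ Set.Ioi b ⊆ dom T := Set.inter_subset_left
  have hmeas : MeasurableSet (dom T ∩ Set.Ioi b) := measurableSet_dom.inter measurableSet_Ioi
  rw [vol] at hm hg ⊢
  rw [hunion]
  refine IntegrableOn.union ((integrableOn_Icc_iff_integrableOn_Ioc).2 hf.1) ?_
  refine Integrable.mono' (IntegrableOn.mono_set hg hsub)
    (hm.mono_measure (Measure.restrict_mono hsub le_rfl)) ?_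
  rw [ae_restrict_iff' hmeas]
  exact Eventually.of_forall fun t ht => hfg t ht.1 ht.2

theorem exists_tendsto_of_monotoneOn (hT : 0 < T) {g : ℝ → ℝ} (hg : MonotoneOn g (dom T)) {C : ℝ}
    (hC : ∀ t ∈ dom T, g t ≤ C) : ∃ L, Tendsto g (leftOf T) (𝓝 L) := by
  have hne : (g '' dom T).Nonempty := ⟨_, 0, zero_mem_dom hT, rfl⟩
  have hbdd : BddAbove (g '' dom T) := ⟨C, by rintro _ ⟨t, ht, rfl⟩; exact hC t ht⟩
  refine ⟨sSup (g '' dom T), tendsto_order.2 ⟨fun a ha => ?_, fun a ha => ?_⟩⟩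
  · obtain ⟨_, ⟨t, ht, rfl⟩, h⟩ := exists_lt_of_lt_csSup hne ha
    filter_upwards [eventually_leftOf ht] with s hs
    exact h.trans_le (hg ht hs.2 hs.1.le)
  · filter_upwards [eventually_leftOf (zero_mem_dom hT)] with s hs
    exact (le_csSup hbdd ⟨s, hs.2, rfl⟩).trans_lt ha

end Domain

section Density

variable {E : Type*} [NormedAddCommGroup E] [NormedSpace ℝ E]

/-- `F` is locally absolutely continuous on `[0, T)` with derivative `f`. -/
structure HasDensity (T : EReal) (F f : ℝ → E) : Prop where
  integrable : ∀ t ∈ dom T, IntervalIntegrable f volume 0 t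
  eq : ∀ t ∈ dom T, F t = F 0 + ∫ s in (0 : ℝ)..t, f s

theorem isAC_iff {𝕜 : Type*} [RCLike 𝕜] {T : EReal} {v : ℝ → Fin 2 → 𝕜} :
    IsAC T v ↔ ∃ g, HasDensity T v g :=
  ⟨fun ⟨g, hg⟩ => ⟨g, fun t ht => (hg t ht).1, fun t ht => (hg t ht).2⟩,
    fun ⟨g, hg⟩ => ⟨g, fun t ht => ⟨hg.1 t ht, hg.2 t ht⟩⟩⟩

theorem _root_.AbsolutelyContinuousOnInterval.of_dist_le {X Y : Type*} [PseudoMetricSpace X]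
    [PseudoMetricSpace Y] {F : ℝ → X} {G : ℝ → Y} {a b C : ℝ}
    (hG : AbsolutelyContinuousOnInterval G a b)
    (h : ∀ x ∈ Set.uIcc a b, ∀ y ∈ Set.uIcc a b, dist (F x) (F y) ≤ C * dist (G x) (G y)) :
    AbsolutelyContinuousOnInterval F a b := by
  have h2 := (Tendsto.const_mul C hG)
  rw [mul_zero] at h2
  refine squeeze_zero' (Eventually.of_forall fun _ => Finset.sum_nonneg fun _ _ => dist_nonneg) ?_
    h2
  rw [eventually_inf_principal]
  filter_upwards with E hE
  rw [Finset.mul_sum]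
  exact Finset.sum_le_sum fun i hi => h _ (hE.1 i hi).1 _ (hE.1 i hi).2

theorem _root_.AbsolutelyContinuousOnInterval.contDiff_comp {E' : Type*} [NormedAddCommGroup E']
    [NormedSpace ℝ E'] [ProperSpace E] {F : ℝ → E} {a b : ℝ} {Ψ : E → E'} (hΨ : ContDiff ℝ 1 Ψ)
    (hF : AbsolutelyContinuousOnInterval F a b) :
    AbsolutelyContinuousOnInterval (fun t => Ψ (F t)) a b := by
  obtain ⟨C, hC⟩ := hF.exists_bound
  obtain ⟨K, hK⟩ := (hΨ.contDiffOn (s := Metric.closedBall 0 C)).exists_lipschitzOnWith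
    (by decide) (convex_closedBall _ _) (isCompact_closedBall _ _)
  exact hF.of_dist_le fun x hx y hy => hK.dist_le_mul _ (by simpa using hC x hx) _
    (by simpa using hC y hy)

variable {T : EReal} {F f G g : ℝ → E}

namespace HasDensity

theorem intervalIntegrable (h : HasDensity T F f) {s t : ℝ} (hs : s ∈ dom T) (ht : t ∈ dom T) :
    IntervalIntegrable f volume s t := (h.1 s hs).symm.trans (h.1 t ht)

theorem sub_eq (h : HasDensity T F f) {s t : ℝ} (hs : s ∈ dom T) (ht : t ∈ dom T) :
    F t - F s = ∫ x in s..t, f x := by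
  rw [h.2 s hs, h.2 t ht, ← intervalIntegral.integral_interval_sub_left (h.1 t ht) (h.1 s hs)]
  abel

theorem absolutelyContinuous (h : HasDensity T F f) {b : ℝ} (hb : b ∈ dom T) :
    AbsolutelyContinuousOnInterval F 0 b := by
  refine ((h.1 b hb).norm.absolutelyContinuousOnInterval_intervalIntegral
    Set.left_mem_uIcc).of_dist_le (C := 1) fun x hx y hy => ?_
  rw [Set.uIcc_of_le hb.1] at hx hy
  have hx' := Icc_subset_dom le_rfl hb hx
  have hy' := Icc_subset_dom le_rfl hb hy
  rw [dist_comm, dist_comm (∫ _ in _.._, _), one_mul, dist_eq_norm, h.sub_eq hx' hy',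
    Real.dist_eq, intervalIntegral.integral_interval_sub_left (h.1 y hy').norm (h.1 x hx').norm]
  exact intervalIntegral.norm_integral_le_abs_integral_norm

theorem continuousOn (h : HasDensity T F f) : ContinuousOn F (dom T) := by
  intro t ht
  obtain ⟨q, h1, h2⟩ := exists_gt_mem_dom ht
  have := (h.absolutelyContinuous h2).continuousOn
  rw [Set.uIcc_of_le h2.1] at this
  refine (this t ⟨ht.1, h1.le⟩).mono_of_mem_nhdsWithin ?_
  filter_upwards [self_mem_nhdsWithin, mem_nhdsWithin_of_mem_nhds (Iio_mem_nhds h1)] with x hx hx2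
    using ⟨hx.1, hx2.le⟩

theorem hasDerivAt [CompleteSpace E] (h : HasDensity T F f) :
    ∀ᵐ t ∂(vol T), HasDerivAt F (f t) t := by
  refine ae_vol_of_forall_Icc fun b hb => ?_
  obtain ⟨q, h1, h2⟩ := exists_gt_mem_dom hb
  have h0 : ∀ᵐ x : ℝ, x ≠ 0 := by simp [ae_iff, measure_singleton]
  filter_upwards [(h.1 q h2).ae_hasDerivAt_integral, h0] with t ht ht0 htb
  rw [Set.uIcc_of_le h2.1] at ht
  refine ((ht ⟨htb.1, htb.2.trans h1.le⟩ 0 ⟨le_rfl, h2.1⟩).const_add (F 0)).congr_of_eventuallyEq ?_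
  filter_upwards [Ioo_mem_nhds (lt_of_le_of_ne htb.1 ht0.symm) (htb.2.trans_lt h1)] with x hx
  exact h.2 x (Icc_subset_dom le_rfl h2 ⟨hx.1.le, hx.2.le⟩)

theorem congr (h : HasDensity T F f) (hfg : f =ᵐ[vol T] g) : HasDensity T F g := by
  have key : ∀ t ∈ dom T, f =ᵐ[volume.restrict (Set.uIoc 0 t)] g := fun t ht => by
    rw [Filter.EventuallyEq, ae_restrict_iff' measurableSet_uIoc, Set.uIoc_of_le ht.1]
    filter_upwards [ae_Icc_of_ae_vol hfg ht] with x hx hx2 using hx ⟨hx2.1.le, hx2.2⟩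
  refine ⟨fun t ht => (h.1 t ht).congr_ae (key t ht), fun t ht => ?_⟩
  rw [h.2 t ht, intervalIntegral.integral_congr_ae_restrict (key t ht)]

theorem congr_left (h : HasDensity T F f) (hT : 0 < T) (hFG : Set.EqOn F G (dom T)) :
    HasDensity T G f :=
  ⟨h.1, fun t ht => by rw [← hFG ht, ← hFG (zero_mem_dom hT)]; exact h.2 t ht⟩

theorem of_integral (hf : ∀ t ∈ dom T, IntervalIntegrable f volume 0 t) (c : E) :
    HasDensity T (fun t => c + ∫ s in (0 : ℝ)..t, f s) f :=
  ⟨hf, fun t _ => by simp⟩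

theorem of_absolutelyContinuous [CompleteSpace E]
    (hF : ∀ b ∈ dom T, AbsolutelyContinuousOnInterval F 0 b)
    (hd : ∀ᵐ t ∂(vol T), HasDerivAt F (f t) t)
    (hf : ∀ t ∈ dom T, IntervalIntegrable f volume 0 t) : HasDensity T F f := by
  refine ⟨hf, fun b hb => ?_⟩
  have hI := of_integral hf (0 : E)
  have hsub := (hF b hb).sub (hI.absolutelyContinuous hb)
  obtain ⟨C, hC⟩ := hsub.const_of_ae_hasDerivAt_zero (by
    rw [Set.uIcc_of_le hb.1]
    filter_upwards [ae_Icc_of_ae_vol hd hb, ae_Icc_of_ae_vol hI.hasDerivAt hb] with t h1 h2 ht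
    simpa using (h1 ht).sub (h2 ht))
  have h1 := hC b Set.right_mem_uIcc
  have h2 := hC 0 Set.left_mem_uIcc
  simp only [Pi.sub_apply, zero_add, intervalIntegral.integral_same, sub_zero] at h1 h2
  rw [h2, ← h1]
  abel

theorem clm_comp [CompleteSpace E] {E' : Type*} [NormedAddCommGroup E'] [NormedSpace ℝ E']
    [CompleteSpace E']
    (L : E →L[ℝ] E') (h : HasDensity T F f) : HasDensity T (fun t => L (F t)) fun t => L (f t) := by
  refine ⟨fun t ht => ⟨L.integrable_comp (h.1 t ht).1, L.integrable_comp (h.1 t ht).2⟩,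
    fun t ht => ?_⟩
  rw [L.intervalIntegral_comp_comm (h.1 t ht), h.2 t ht, map_add]

theorem pi {ι : Type*} [Fintype ι] {F f : ℝ → ι → E} [CompleteSpace E]
    (h : ∀ i, HasDensity T (fun t => F t i) fun t => f t i) : HasDensity T F f := by
  have hint : ∀ t ∈ dom T, IntervalIntegrable f volume 0 t := fun t ht =>
    ⟨Integrable.of_eval fun i => ((h i).1 t ht).1, Integrable.of_eval fun i => ((h i).1 t ht).2⟩
  refine ⟨hint, fun t ht => ?_⟩
  ext i
  have := (ContinuousLinearMap.proj (R := ℝ) (φ := fun _ : ι => E) i).intervalIntegral_comp_comm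
    (hint t ht)
  simp only [ContinuousLinearMap.proj_apply] at this
  rw [Pi.add_apply, ← this]
  exact (h i).2 t ht

theorem add (hF : HasDensity T F f) (hG : HasDensity T G g) :
    HasDensity T (fun t => F t + G t) fun t => f t + g t := by
  refine ⟨fun t ht => (hF.1 t ht).add (hG.1 t ht), fun t ht => ?_⟩
  rw [intervalIntegral.integral_add (hF.1 t ht) (hG.1 t ht), hF.2 t ht, hG.2 t ht]
  abel

theorem const (c : E) : HasDensity T (fun _ => c) fun _ => (0 : E) :=
  ⟨fun t _ => by simp, fun t _ => by simp⟩

theorem neg (hF : HasDensity T F f) : HasDensity T (fun t => -F t) fun t => -f t := by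
  refine ⟨fun t ht => (hF.1 t ht).neg, fun t ht => ?_⟩
  rw [intervalIntegral.integral_neg, hF.2 t ht]
  abel

theorem sub (hF : HasDensity T F f) (hG : HasDensity T G g) :
    HasDensity T (fun t => F t - G t) fun t => f t - g t := by
  simpa only [sub_eq_add_neg] using hF.add hG.neg

section Algebra

variable {𝕜 : Type*} [RCLike 𝕜] {F f G g : ℝ → 𝕜}

theorem mul (hF : HasDensity T F f) (hG : HasDensity T G g) :
    HasDensity T (fun t => F t * G t) fun t => f t * G t + F t * g t := by
  refine of_absolutelyContinuous (fun b hb => ?_) ?_ fun t ht => ?_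
  · exact (hF.absolutelyContinuous hb).fun_smul (hG.absolutelyContinuous hb)
  · filter_upwards [hF.hasDerivAt, hG.hasDerivAt] with t h1 h2 using h1.mul h2
  · refine ((hF.1 t ht).mul_continuousOn (hG.continuousOn.mono ?_)).add
      ((hG.1 t ht).continuousOn_mul (hF.continuousOn.mono ?_)) <;>
    · rw [Set.uIcc_of_le ht.1]; exact Icc_subset_dom le_rfl ht

theorem const_mul (c : 𝕜) (hF : HasDensity T F f) :
    HasDensity T (fun t => c * F t) fun t => c * f t := by
  simpa using (const c).mul hF

theorem star (hF : HasDensity T F f) :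
    HasDensity T (fun t => Star.star (F t)) fun t => Star.star (f t) :=
  hF.clm_comp (RCLike.conjCLE (K := 𝕜)).toContinuousLinearMap

theorem re (hF : HasDensity T F f) :
    HasDensity T (fun t => RCLike.re (F t)) fun t => RCLike.re (f t) :=
  hF.clm_comp (RCLike.reCLM (K := 𝕜))

end Algebra

theorem rexp {F f : ℝ → ℝ} (hF : HasDensity T F f) :
    HasDensity T (fun t => Real.exp (F t)) fun t => Real.exp (F t) * f t := by
  refine of_absolutelyContinuous
    (fun b hb => (hF.absolutelyContinuous hb).contDiff_comp Real.contDiff_exp) ?_ fun t ht => ?_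
  · filter_upwards [hF.hasDerivAt] with t h1 using h1.exp
  · refine (hF.1 t ht).continuousOn_mul (Real.continuous_exp.comp_continuousOn
      (hF.continuousOn.mono ?_))
    rw [Set.uIcc_of_le ht.1]; exact Icc_subset_dom le_rfl ht

theorem cexp {F f : ℝ → ℂ} (hF : HasDensity T F f) :
    HasDensity T (fun t => Complex.exp (F t)) fun t => Complex.exp (F t) * f t := by
  refine of_absolutelyContinuous
    (fun b hb => (hF.absolutelyContinuous hb).contDiff_comp Complex.contDiff_exp) ?_ fun t ht => ?_
  · filter_upwards [hF.hasDerivAt] with t h1 using h1.cexp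
  · refine (hF.1 t ht).continuousOn_mul (Complex.continuous_exp.comp_continuousOn
      (hF.continuousOn.mono ?_))
    rw [Set.uIcc_of_le ht.1]; exact Icc_subset_dom le_rfl ht

theorem eq_of_ae_zero (h : HasDensity T F f) (hf : f =ᵐ[vol T] 0) {t : ℝ} (ht : t ∈ dom T) :
    F t = F 0 := by
  have := (h.congr hf).2 t ht
  simpa using this

theorem monotoneOn {F f : ℝ → ℝ} (h : HasDensity T F f) (hf : ∀ t ∈ dom T, 0 ≤ f t) :
    MonotoneOn F (dom T) := fun s hs t ht hst => by
  rw [← sub_nonneg, h.sub_eq hs ht]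
  exact intervalIntegral.integral_nonneg hst fun x hx => hf x (Icc_subset_dom hs.1 ht hx)

end HasDensity

theorem HasDensity.mul_exp_neg {F κ g : ℝ → ℝ} (hκ : ∀ t ∈ dom T, IntervalIntegrable κ volume 0 t)
    (hF : HasDensity T F fun t => g t + κ t * F t) :
    HasDensity T (fun t => F t * Real.exp (-∫ s in (0 : ℝ)..t, κ s))
      fun t => g t * Real.exp (-∫ s in (0 : ℝ)..t, κ s) := by
  have hK := (HasDensity.of_integral hκ 0).neg.rexp
  simp only [zero_add] at hK
  refine (hF.mul hK).congr (Eventually.of_forall fun t => ?_)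
  simp only
  ring

theorem HasDensity.eq_mul_exp {F κ : ℝ → ℝ} (hκ : ∀ t ∈ dom T, IntervalIntegrable κ volume 0 t)
    (hF : HasDensity T F fun t => κ t * F t) {t : ℝ} (ht : t ∈ dom T) :
    F t = F 0 * Real.exp (∫ s in (0 : ℝ)..t, κ s) := by
  have h := (HasDensity.mul_exp_neg (g := fun _ => 0) hκ (by simpa using hF)).eq_of_ae_zero
    (Eventually.of_forall fun t => by simp) ht
  simp only [intervalIntegral.integral_same, neg_zero, Real.exp_zero, mul_one] at h
  rw [← h, mul_assoc, ← Real.exp_add]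
  simp

theorem HasDensity.eq_mul_cexp {F κ : ℝ → ℂ} (hκ : ∀ t ∈ dom T, IntervalIntegrable κ volume 0 t)
    (hF : HasDensity T F fun t => κ t * F t) {t : ℝ} (ht : t ∈ dom T) :
    F t = F 0 * Complex.exp (∫ s in (0 : ℝ)..t, κ s) := by
  have hK := (HasDensity.of_integral hκ 0).neg.cexp
  simp only [zero_add] at hK
  have h := (hF.mul hK).eq_of_ae_zero (Eventually.of_forall fun t => by simp only [Pi.zero_apply]; ring) ht
  simp only [intervalIntegral.integral_same, neg_zero, Complex.exp_zero, mul_one] at h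
  rw [← h, mul_assoc, ← Complex.exp_add]
  simp

end Density

/-- The sum of the absolute values of the independent entries of a symmetric `2 × 2` matrix. -/
def entrySum (R : Matrix (Fin 2) (Fin 2) ℝ) : ℝ := |R 0 0| + |R 0 1| + |R 1 1|

theorem entrySum_nonneg (R : Matrix (Fin 2) (Fin 2) ℝ) : 0 ≤ entrySum R := by
  unfold entrySum; positivity

theorem _root_.Matrix.PosDef.apply_one_zero {R : Matrix (Fin 2) (Fin 2) ℝ} (hR : R.PosDef) :
    R 1 0 = R 0 1 := by
  simpa using hR.isHermitian.apply 0 1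

section Vector

variable {𝕜 : Type*} [RCLike 𝕜]

/-- The squared Euclidean norm. -/
noncomputable def normSq (w : Fin 2 → 𝕜) : ℝ := ‖w 0‖ ^ 2 + ‖w 1‖ ^ 2

theorem normSq_nonneg (w : Fin 2 → 𝕜) : 0 ≤ normSq w := by
  unfold normSq; positivity

theorem normSq_eq_zero {w : Fin 2 → 𝕜} : normSq w = 0 ↔ w = 0 := by
  constructor
  · intro h
    unfold normSq at h
    have h0 : ‖w 0‖ ^ 2 = 0 := by nlinarith [sq_nonneg ‖w 0‖, sq_nonneg ‖w 1‖]
    have h1 : ‖w 1‖ ^ 2 = 0 := by nlinarith [sq_nonneg ‖w 0‖, sq_nonneg ‖w 1‖]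
    exact funext (Fin.forall_fin_two.2 ⟨by simpa using h0, by simpa using h1⟩)
  · rintro rfl; simp [normSq]

/-- The real number `w* R w`. -/
noncomputable def quad (R : Matrix (Fin 2) (Fin 2) ℝ) (w : Fin 2 → 𝕜) : ℝ :=
  R 0 0 * ‖w 0‖ ^ 2 + 2 * R 0 1 * RCLike.re (star (w 0) * w 1) + R 1 1 * ‖w 1‖ ^ 2

theorem pairing_self {R : ℝ → Matrix (Fin 2) (Fin 2) ℝ} {t : ℝ} (hR : (R t).PosDef)
    (w : ℝ → Fin 2 → 𝕜) : pairing R w w t = (quad (R t) (w t) : 𝕜) := by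
  simp only [pairing, quad, dotProduct, Matrix.mulVec, Fin.sum_univ_two, Matrix.map_apply,
    hR.apply_one_zero, RCLike.norm_sq_eq_def]
  apply RCLike.ext <;> simp <;> ring

theorem quad_pos {R : Matrix (Fin 2) (Fin 2) ℝ} (hR : R.PosDef) {w : Fin 2 → 𝕜} (hw : w ≠ 0) :
    0 < quad R w := by
  have ha : 0 < R 0 0 := hR.diag_pos
  have hd : 0 < R 0 0 * R 1 1 - R 0 1 * R 0 1 := by
    have := hR.det_pos
    rwa [Matrix.det_fin_two, hR.apply_one_zero] at this
  have hn : 0 < normSq w := lt_of_le_of_ne (normSq_nonneg w) fun h => hw (normSq_eq_zero.1 h.symm)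
  simp only [quad, normSq, RCLike.norm_sq_eq_def, RCLike.mul_re, RCLike.star_def, RCLike.conj_re,
    RCLike.conj_im] at hn ⊢
  generalize RCLike.re (w 0) = x at *
  generalize RCLike.im (w 0) = y at *
  generalize RCLike.re (w 1) = p at *
  generalize RCLike.im (w 1) = q at *
  generalize R 0 0 = a at *
  generalize R 0 1 = b at *
  generalize R 1 1 = d at *
  have key : a * (a * (x * x + y * y) + 2 * b * (x * p - -y * q) + d * (p * p + q * q)) =
      (a * x + b * p) ^ 2 + (a * y + b * q) ^ 2 + (a * d - b * b) * (p ^ 2 + q ^ 2) := by ring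
  refine pos_of_mul_pos_right (a := a) ?_ ha.le
  rw [key]
  rcases (by positivity : 0 ≤ p ^ 2 + q ^ 2).eq_or_lt with h | h
  · have hp : p = 0 := by nlinarith [sq_nonneg p, sq_nonneg q]
    have hq : q = 0 := by nlinarith [sq_nonneg p, sq_nonneg q]
    subst hp hq
    have : 0 < a ^ 2 * (x * x + y * y) := mul_pos (by positivity) (by linarith)
    nlinarith
  · have := mul_pos hd h
    positivity

theorem quad_nonneg {R : Matrix (Fin 2) (Fin 2) ℝ} (hR : R.PosDef) (w : Fin 2 → 𝕜) :
    0 ≤ quad R w := by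
  by_cases h : w = 0
  · simp [h, quad]
  · exact (quad_pos hR h).le

theorem norm_mul_norm_le (w : Fin 2 → 𝕜) : ‖w 0‖ * ‖w 1‖ ≤ normSq w / 2 := by
  unfold normSq; nlinarith [sq_nonneg (‖w 0‖ - ‖w 1‖)]

theorem quad_le (R : Matrix (Fin 2) (Fin 2) ℝ) (w : Fin 2 → 𝕜) :
    quad R w ≤ entrySum R * normSq w := by
  have h1 : |RCLike.re (star (w 0) * w 1)| ≤ normSq w / 2 :=
    (RCLike.abs_re_le_norm _).trans (by simpa using norm_mul_norm_le w)
  have h2 : R 0 1 * RCLike.re (star (w 0) * w 1) ≤ |R 0 1| * (normSq w / 2) :=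
    (le_abs_self _).trans (by rw [abs_mul]; gcongr)
  have h3 : R 0 0 * ‖w 0‖ ^ 2 ≤ |R 0 0| * normSq w := by
    have : ‖w 0‖ ^ 2 ≤ normSq w := by unfold normSq; nlinarith [sq_nonneg ‖w 1‖]
    exact mul_le_mul (le_abs_self _) this (by positivity) (abs_nonneg _)
  have h4 : R 1 1 * ‖w 1‖ ^ 2 ≤ |R 1 1| * normSq w := by
    have : ‖w 1‖ ^ 2 ≤ normSq w := by unfold normSq; nlinarith [sq_nonneg ‖w 0‖]
    exact mul_le_mul (le_abs_self _) this (by positivity) (abs_nonneg _)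
  unfold quad entrySum
  linarith

theorem tau_eq_iff {R : ℝ → Matrix (Fin 2) (Fin 2) ℝ} {t : ℝ} (hR : (R t).PosDef)
    {w : ℝ → Fin 2 → 𝕜} {g x : Fin 2 → 𝕜} (hg : HasDerivAt w g t) :
    tau R w t = x ↔ g 0 = (R t 0 1 : 𝕜) * x 0 + (R t 1 1 : 𝕜) * x 1 ∧
      g 1 = -((R t 0 0 : 𝕜) * x 0 + (R t 0 1 : 𝕜) * x 1) := by
  have hdet : IsUnit (R t).det := hR.det_pos.ne'.isUnit
  have hmul : ∀ A B : Matrix (Fin 2) (Fin 2) ℝ, A * B = 1 →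
      A.map (RCLike.ofReal : ℝ → 𝕜) * B.map (RCLike.ofReal : ℝ → 𝕜) = 1 := fun A B h => by
    have := congrArg (fun M => M.map (RCLike.ofRealAm (K := 𝕜)).toRingHom) h
    simp only [Matrix.map_mul] at this
    refine Eq.trans ?_ (this.trans ?_)
    · rfl
    · simp
  have h1 := hmul _ _ (Matrix.mul_nonsing_inv _ hdet)
  have h2 := hmul _ _ (Matrix.nonsing_inv_mul _ hdet)
  have key : tau R w t = x ↔
      (J 𝕜).mulVec g = ((R t).map (RCLike.ofReal : ℝ → 𝕜)).mulVec x := by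
    rw [tau, hg.deriv]
    constructor
    · rintro rfl
      rw [Matrix.mulVec_mulVec, h1, Matrix.one_mulVec]
    · intro h
      rw [h, Matrix.mulVec_mulVec, h2, Matrix.one_mulVec]
  rw [key, funext_iff, Fin.forall_fin_two, and_comm]
  simp only [J, Matrix.mulVec, dotProduct, Fin.sum_univ_two, Matrix.map_apply, hR.apply_one_zero]
  simp [neg_eq_iff_eq_neg]

end Vector

section Admissible

variable {R : ℝ → Matrix (Fin 2) (Fin 2) ℝ} {T : EReal}

theorem Admissible.intervalIntegrable (hR : Admissible R T) (i j : Fin 2) {t : ℝ} (ht : t ∈ dom T) :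
    IntervalIntegrable (fun s => R s i j) volume 0 t := by
  obtain ⟨C, hC⟩ := hR.bounded t ht
  rw [intervalIntegrable_iff_integrableOn_Ioc_of_le ht.1]
  have hsub : Set.Ioc 0 t ⊆ dom T := fun x hx => Icc_subset_dom le_rfl ht ⟨hx.1.le, hx.2⟩
  have hm : AEStronglyMeasurable (fun s => R s i j) (volume.restrict (Set.Ioc 0 t)) :=
    (hR.measurable i j).mono_measure (Measure.restrict_mono hsub le_rfl)
  refine Integrable.mono' (integrable_const C) hm ?_
  rw [ae_restrict_iff' measurableSet_Ioc]
  exact Eventually.of_forall fun x hx => hC x ⟨hx.1.le, hx.2⟩ i j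

theorem Admissible.intervalIntegrable_entrySum (hR : Admissible R T) {t : ℝ} (ht : t ∈ dom T) :
    IntervalIntegrable (fun s => entrySum (R s)) volume 0 t :=
  ((hR.intervalIntegrable 0 0 ht).abs.add (hR.intervalIntegrable 0 1 ht).abs).add
    (hR.intervalIntegrable 1 1 ht).abs

theorem LimitCircle.integrable_entrySum (hLC : LimitCircle R T) :
    Integrable (fun s => entrySum (R s)) (vol T) :=
  ((hLC 0 0).abs.add (hLC 0 1).abs).add (hLC 1 1).abs

theorem LimitCircle.integral_entrySum_le (hLC : LimitCircle R T) {t : ℝ} (ht : t ∈ dom T) :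
    ∫ s in (0 : ℝ)..t, entrySum (R s) ≤ ∫ s, entrySum (R s) ∂(vol T) := by
  rw [intervalIntegral.integral_of_le ht.1]
  refine setIntegral_mono_set hLC.integrable_entrySum
    (Eventually.of_forall fun s => entrySum_nonneg _) (LE.le.eventuallyLE ?_)
  exact fun x hx => Icc_subset_dom le_rfl ht ⟨hx.1.le, hx.2⟩

theorem Admissible.abs_integral_le (hR : Admissible R T) {κ : ℝ → ℝ} {c : ℝ}
    (hκ : ∀ t ∈ dom T, |κ t| ≤ c * entrySum (R t)) {t : ℝ} (ht : t ∈ dom T) :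
    |∫ s in (0 : ℝ)..t, κ s| ≤ c * ∫ s in (0 : ℝ)..t, entrySum (R s) := by
  rw [← intervalIntegral.integral_const_mul]
  refine intervalIntegral.norm_integral_le_of_norm_le (E := ℝ) ht.1 (Eventually.of_forall fun s hs => ?_)
    ((hR.intervalIntegrable_entrySum ht).const_mul c)
  exact hκ s (Icc_subset_dom le_rfl ht ⟨hs.1.le, hs.2⟩)

theorem LimitCircle.abs_integral_le (hLC : LimitCircle R T) (hR : Admissible R T) {κ : ℝ → ℝ}
    {c : ℝ} (hc : 0 ≤ c) (hκ : ∀ t ∈ dom T, |κ t| ≤ c * entrySum (R t)) {t : ℝ} (ht : t ∈ dom T) :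
    |∫ s in (0 : ℝ)..t, κ s| ≤ c * ∫ s, entrySum (R s) ∂(vol T) :=
  (hR.abs_integral_le hκ ht).trans (mul_le_mul_of_nonneg_left (hLC.integral_entrySum_le ht) hc)

theorem Admissible.intervalIntegrable_of_le (hR : Admissible R T) {E : Type*} [NormedAddCommGroup E]
    {κ : ℝ → E} {c : ℝ}
    (hκ : ∀ t ∈ dom T, ‖κ t‖ ≤ c * entrySum (R t)) {t : ℝ} (ht : t ∈ dom T)
    (hm : AEStronglyMeasurable κ (volume.restrict (Set.Ioc 0 t))) :
    IntervalIntegrable κ volume 0 t := by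
  have h := (hR.intervalIntegrable_entrySum ht).const_mul c
  rw [intervalIntegrable_iff_integrableOn_Ioc_of_le ht.1] at h ⊢
  refine Integrable.mono' h hm ?_
  rw [ae_restrict_iff' measurableSet_Ioc]
  exact Eventually.of_forall fun s hs => hκ s (Icc_subset_dom le_rfl ht ⟨hs.1.le, hs.2⟩)

end Admissible

section System

variable {𝕜 : Type*} [RCLike 𝕜] {R : ℝ → Matrix (Fin 2) (Fin 2) ℝ} {T : EReal}

/-- The first order system equivalent to `τ w = μ w`. -/
structure IsSystem (R : ℝ → Matrix (Fin 2) (Fin 2) ℝ) (T : EReal) (μ : 𝕜) (w : ℝ → Fin 2 → 𝕜) :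
    Prop where
  fst : HasDensity T (fun t => w t 0)
    fun t => μ * ((R t 0 1 : 𝕜) * w t 0 + (R t 1 1 : 𝕜) * w t 1)
  snd : HasDensity T (fun t => w t 1)
    fun t => -(μ * ((R t 0 0 : 𝕜) * w t 0 + (R t 0 1 : 𝕜) * w t 1))

theorem isSystem_of_tau (hR : Admissible R T) {μ : 𝕜} {w : ℝ → Fin 2 → 𝕜} (hw : IsAC T w)
    (h : tau R w =ᵐ[vol T] fun t => μ • w t) : IsSystem R T μ w := by
  obtain ⟨g, hg⟩ := isAC_iff.1 hw
  have hpd : ∀ᵐ t ∂(vol T), (R t).PosDef :=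
    (ae_restrict_iff' measurableSet_dom).2 (Eventually.of_forall hR.posDef)
  have hcomp : ∀ i, HasDensity T (fun t => w t i) fun t => g t i := fun i =>
    hg.clm_comp (ContinuousLinearMap.proj (R := ℝ) (φ := fun _ : Fin 2 => 𝕜) i)
  constructor
  · refine (hcomp 0).congr ?_
    filter_upwards [hpd, h, hg.hasDerivAt] with t h1 h2 h3
    rw [((tau_eq_iff h1 h3).1 h2).1]
    simp only [Pi.smul_apply, smul_eq_mul]
    ring
  · refine (hcomp 1).congr ?_
    filter_upwards [hpd, h, hg.hasDerivAt] with t h1 h2 h3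
    rw [((tau_eq_iff h1 h3).1 h2).2]
    simp only [Pi.smul_apply, smul_eq_mul]
    ring

namespace IsSystem

variable {μ : 𝕜} {w : ℝ → Fin 2 → 𝕜}

theorem hasDensity (h : IsSystem R T μ w) : HasDensity T w fun t =>
    ![μ * ((R t 0 1 : 𝕜) * w t 0 + (R t 1 1 : 𝕜) * w t 1),
      -(μ * ((R t 0 0 : 𝕜) * w t 0 + (R t 0 1 : 𝕜) * w t 1))] :=
  HasDensity.pi (Fin.forall_fin_two.2 ⟨h.1, h.2⟩)

theorem isAC (h : IsSystem R T μ w) : IsAC T w := isAC_iff.2 ⟨_, h.hasDensity⟩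

theorem continuousOn (h : IsSystem R T μ w) : ContinuousOn w (dom T) := h.hasDensity.continuousOn

theorem tau_eq (hR : Admissible R T) (h : IsSystem R T μ w) :
    tau R w =ᵐ[vol T] fun t => μ • w t := by
  have hpd : ∀ᵐ t ∂(vol T), (R t).PosDef :=
    (ae_restrict_iff' measurableSet_dom).2 (Eventually.of_forall hR.posDef)
  filter_upwards [hpd, h.hasDensity.hasDerivAt] with t h1 h2
  refine (tau_eq_iff h1 h2).2 ⟨?_, ?_⟩ <;>
  · simp only [Matrix.cons_val_zero, Matrix.cons_val_one, Pi.smul_apply, smul_eq_mul]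
    ring

theorem sub_smul {v : ℝ → Fin 2 → 𝕜} (h : IsSystem R T μ w) (hv : IsSystem R T μ v) (c : 𝕜) :
    IsSystem R T μ fun t => w t - c • v t := by
  constructor
  · refine (h.1.sub (hv.1.const_mul c)).congr (Eventually.of_forall fun t => ?_)
    simp only [Pi.sub_apply, Pi.smul_apply, smul_eq_mul]
    ring
  · refine (h.2.sub (hv.2.const_mul c)).congr (Eventually.of_forall fun t => ?_)
    simp only [Pi.sub_apply, Pi.smul_apply, smul_eq_mul]
    ring

theorem ofReal {lam : ℝ} {v : ℝ → Fin 2 → ℝ} (h : IsSystem R T lam v) :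
    IsSystem R T (lam : 𝕜) fun t i => (v t i : 𝕜) := by
  constructor
  · refine (h.1.clm_comp (RCLike.ofRealCLM (K := 𝕜))).congr (Eventually.of_forall fun t => ?_)
    simp
  · refine (h.2.clm_comp (RCLike.ofRealCLM (K := 𝕜))).congr (Eventually.of_forall fun t => ?_)
    simp

theorem normSq_eq (hR : Admissible R T) (h : IsSystem R T μ w) :
    ∃ κ : ℝ → ℝ, (∀ t, |κ t| ≤ 2 * ‖μ‖ * entrySum (R t)) ∧
      ∀ t ∈ dom T, normSq (w t) = normSq (w 0) * Real.exp (∫ s in (0 : ℝ)..t, κ s) := by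
  have hN := ((h.1.star.mul h.1).re).add ((h.2.star.mul h.2).re)
  have hNeq : (fun t => RCLike.re (star (w t 0) * w t 0) + RCLike.re (star (w t 1) * w t 1)) =
      fun t => normSq (w t) := by
    funext t
    simp [normSq, RCLike.conj_mul, ← RCLike.ofReal_pow, -map_pow]
  rw [hNeq] at hN
  set n : ℝ → ℝ := _ with hn
  change HasDensity T _ n at hN
  have hbound : ∀ t, |n t| ≤ 2 * ‖μ‖ * entrySum (R t) * normSq (w t) := fun t => by
    have e : n t = 2 * RCLike.re (μ * (star (w t 0) * ((R t 0 1 : 𝕜) * w t 0 + (R t 1 1 : 𝕜) * w t 1)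
        - star (w t 1) * ((R t 0 0 : 𝕜) * w t 0 + (R t 0 1 : 𝕜) * w t 1))) := by
      rw [hn]
      simp
      ring
    rw [e, abs_mul, abs_two, mul_assoc, mul_assoc]
    refine mul_le_mul_of_nonneg_left ((RCLike.abs_re_le_norm _).trans ?_) zero_le_two
    rw [norm_mul]
    refine mul_le_mul_of_nonneg_left ?_ (norm_nonneg _)
    refine (norm_sub_le _ _).trans ?_
    simp only [norm_mul, norm_star]
    have h1 : ‖(R t 0 1 : 𝕜) * w t 0 + (R t 1 1 : 𝕜) * w t 1‖ ≤
        |R t 0 1| * ‖w t 0‖ + |R t 1 1| * ‖w t 1‖ := (norm_add_le _ _).trans (by simp)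
    have h2 : ‖(R t 0 0 : 𝕜) * w t 0 + (R t 0 1 : 𝕜) * w t 1‖ ≤
        |R t 0 0| * ‖w t 0‖ + |R t 0 1| * ‖w t 1‖ := (norm_add_le _ _).trans (by simp)
    have h3 := mul_le_mul_of_nonneg_left h1 (norm_nonneg (w t 0))
    have h4 := mul_le_mul_of_nonneg_left h2 (norm_nonneg (w t 1))
    have h5 := norm_mul_norm_le (w t)
    have h6 := mul_le_mul_of_nonneg_left h5 (abs_nonneg (R t 0 0))
    have h7 := mul_le_mul_of_nonneg_left h5 (abs_nonneg (R t 1 1))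
    have h8 := mul_nonneg (abs_nonneg (R t 0 0)) (normSq_nonneg (w t))
    have h9 := mul_nonneg (abs_nonneg (R t 1 1)) (normSq_nonneg (w t))
    have h10 : |R t 0 1| * normSq (w t) = |R t 0 1| * ‖w t 0‖ ^ 2 + |R t 0 1| * ‖w t 1‖ ^ 2 := by
      unfold normSq; ring
    unfold entrySum
    nlinarith
  let κ : ℝ → ℝ := fun t => n t / normSq (w t)
  have hκ : ∀ t, |κ t| ≤ 2 * ‖μ‖ * entrySum (R t) := fun t => by
    simp only [κ, abs_div, abs_of_nonneg (normSq_nonneg (w t))]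
    exact div_le_of_le_mul₀ (normSq_nonneg _)
      (mul_nonneg (by positivity) (entrySum_nonneg _)) (hbound t)
  refine ⟨κ, hκ, fun t ht => ?_⟩
  refine HasDensity.eq_mul_exp (F := fun t => normSq (w t)) (κ := κ) (T := T) (fun s hs => ?_)
    (hN.congr (Eventually.of_forall fun s => ?_)) ht
  · refine hR.intervalIntegrable_of_le (fun t _ => hκ t) hs ?_
    have h1 : AEMeasurable n (volume.restrict (Set.Ioc 0 s)) :=
      (hN.1 s hs).1.aestronglyMeasurable.aemeasurable
    have h2 : AEMeasurable (fun t => normSq (w t)) (volume.restrict (Set.Ioc 0 s)) :=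
      ((hN.continuousOn.mono fun x hx => Icc_subset_dom le_rfl hs
        ⟨hx.1.le, hx.2⟩).aestronglyMeasurable measurableSet_Ioc).aemeasurable
    exact (h1.div h2).aestronglyMeasurable
  · simp only [κ]
    by_cases h0 : normSq (w s) = 0
    · have := hbound s
      rw [h0, mul_zero] at this
      rw [h0, mul_zero]
      exact abs_eq_zero.1 (le_antisymm this (abs_nonneg _))
    · rw [div_mul_cancel₀ _ h0]

theorem eq_zero (hR : Admissible R T) (h : IsSystem R T μ w) (h0 : w 0 = 0) {t : ℝ}
    (ht : t ∈ dom T) : w t = 0 := by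
  obtain ⟨κ, -, h2⟩ := h.normSq_eq hR
  rw [← normSq_eq_zero, h2 t ht, normSq_eq_zero.2 h0, zero_mul]

theorem normSq_le (hR : Admissible R T) (hLC : LimitCircle R T) (h : IsSystem R T μ w) :
    ∃ C, ∀ t ∈ dom T, normSq (w t) ≤ C := by
  obtain ⟨κ, h1, h2⟩ := h.normSq_eq hR
  refine ⟨normSq (w 0) * Real.exp (2 * ‖μ‖ * ∫ s, entrySum (R s) ∂(vol T)), fun t ht => ?_⟩
  rw [h2 t ht]
  refine mul_le_mul_of_nonneg_left (Real.exp_le_exp.2 ?_) (normSq_nonneg _)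
  exact (le_abs_self _).trans
    (hLC.abs_integral_le hR (by positivity) (fun t _ => h1 t) ht)

theorem le_normSq (hR : Admissible R T) (hLC : LimitCircle R T) (h : IsSystem R T μ w)
    (h0 : w 0 ≠ 0) : ∃ c > 0, ∀ t ∈ dom T, c ≤ normSq (w t) := by
  obtain ⟨κ, h1, h2⟩ := h.normSq_eq hR
  have hpos : 0 < normSq (w 0) :=
    lt_of_le_of_ne (normSq_nonneg _) fun h => h0 (normSq_eq_zero.1 h.symm)
  refine ⟨_, mul_pos hpos (Real.exp_pos (-(2 * ‖μ‖ * ∫ s, entrySum (R s) ∂(vol T)))),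
    fun t ht => ?_⟩
  rw [h2 t ht]
  refine mul_le_mul_of_nonneg_left (Real.exp_le_exp.2 ?_) (normSq_nonneg _)
  exact neg_le_of_abs_le (hLC.abs_integral_le hR (by positivity) (fun t _ => h1 t) ht)

end IsSystem

end System

section Angle

/-- The value of the quadratic form of `A` on the unit vector `angleVec x`. -/
noncomputable def angleEnergy (A : Matrix (Fin 2) (Fin 2) ℝ) (x : ℝ) : ℝ := quad A (angleVec x)

theorem normSq_angleVec (x : ℝ) : normSq (angleVec x) = 1 := by
  simp [normSq, angleVec]

theorem angleVec_ne_zero (x : ℝ) : angleVec x ≠ 0 := fun h => by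
  have := normSq_angleVec x
  rw [normSq_eq_zero.2 h] at this
  exact zero_ne_one this

theorem angleEnergy_pos {A : Matrix (Fin 2) (Fin 2) ℝ} (hA : A.PosDef) (x : ℝ) :
    0 < angleEnergy A x := quad_pos hA (angleVec_ne_zero x)

theorem angleEnergy_le (A : Matrix (Fin 2) (Fin 2) ℝ) (x : ℝ) :
    angleEnergy A x ≤ entrySum A := by
  have := quad_le A (angleVec x)
  rwa [normSq_angleVec, mul_one] at this

theorem angleEnergy_eq (A : Matrix (Fin 2) (Fin 2) ℝ) (x : ℝ) :
    angleEnergy A x = A 0 0 * Real.cos (x / 2) ^ 2 - 2 * A 0 1 * (Real.cos (x / 2) * Real.sin (x / 2))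
      + A 1 1 * Real.sin (x / 2) ^ 2 := by
  simp [angleEnergy, quad, angleVec]
  ring

theorem angleEnergy_eq' (A : Matrix (Fin 2) (Fin 2) ℝ) (x : ℝ) :
    angleEnergy A x = (A 0 0 + A 1 1) / 2 + (A 0 0 - A 1 1) / 2 * Real.cos x
      - A 0 1 * Real.sin x := by
  have h1 : Real.cos x = 2 * Real.cos (x / 2) ^ 2 - 1 := by
    rw [← Real.cos_two_mul]; congr 1; ring
  have h2 : Real.sin x = 2 * Real.sin (x / 2) * Real.cos (x / 2) := by
    rw [← Real.sin_two_mul]; congr 1; ring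
  rw [angleEnergy_eq, h1, h2, Real.sin_sq]
  ring

theorem abs_angleEnergy_sub_le (A : Matrix (Fin 2) (Fin 2) ℝ) (x y : ℝ) :
    |angleEnergy A x - angleEnergy A y| ≤ entrySum A * |x - y| := by
  have hc : |Real.cos x - Real.cos y| ≤ |x - y| := by
    simpa [Real.dist_eq] using Real.lipschitzWith_cos.dist_le_mul x y
  have hs : |Real.sin x - Real.sin y| ≤ |x - y| := by
    simpa [Real.dist_eq] using Real.lipschitzWith_sin.dist_le_mul x y
  have e : angleEnergy A x - angleEnergy A y =
      (A 0 0 - A 1 1) / 2 * (Real.cos x - Real.cos y) - A 0 1 * (Real.sin x - Real.sin y) := by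
    rw [angleEnergy_eq', angleEnergy_eq']; ring
  have h1 : |(A 0 0 - A 1 1) / 2| ≤ |A 0 0| + |A 1 1| := by
    rw [abs_div, abs_two]
    have := abs_sub (A 0 0) (A 1 1)
    linarith [abs_nonneg (A 0 0), abs_nonneg (A 1 1)]
  calc _ ≤ |(A 0 0 - A 1 1) / 2| * |Real.cos x - Real.cos y| + |A 0 1| * |Real.sin x - Real.sin y| := by
        rw [e, ← abs_mul, ← abs_mul]; exact abs_sub _ _
    _ ≤ (|A 0 0| + |A 1 1|) * |x - y| + |A 0 1| * |x - y| := by gcongr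
    _ = _ := by unfold entrySum; ring

end Angle

section Phase

variable {R : ℝ → Matrix (Fin 2) (Fin 2) ℝ} {T : EReal}

theorem Admissible.intervalIntegrable_mul (hR : Admissible R T) {g : ℝ → ℝ}
    (hg : ContinuousOn g (dom T)) (i j : Fin 2) {t : ℝ} (ht : t ∈ dom T) :
    IntervalIntegrable (fun s => R s i j * g s) volume 0 t := by
  refine (hR.intervalIntegrable i j ht).mul_continuousOn (hg.mono ?_)
  rw [Set.uIcc_of_le ht.1]
  exact Icc_subset_dom le_rfl ht

theorem Admissible.intervalIntegrable_angleEnergy (hR : Admissible R T) {φ : ℝ → ℝ}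
    (hφ : ContinuousOn φ (dom T)) {t : ℝ} (ht : t ∈ dom T) :
    IntervalIntegrable (fun s => angleEnergy (R s) (φ s)) volume 0 t := by
  have hc : ContinuousOn (fun t => Real.cos (φ t / 2)) (dom T) := by fun_prop
  have hs : ContinuousOn (fun t => Real.sin (φ t / 2)) (dom T) := by fun_prop
  refine (((hR.intervalIntegrable_mul (hc.pow 2) 0 0 ht).sub
    ((hR.intervalIntegrable_mul (hc.mul hs) 0 1 ht).const_mul 2)).add
    (hR.intervalIntegrable_mul (hs.pow 2) 1 1 ht)).congr fun s _ => ?_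
  rw [angleEnergy_eq]
  simp
  ring

theorem eq_zero_of_continuousOn_int {δ : ℝ → ℝ} (hδ : ContinuousOn δ (dom T)) (h0 : δ 0 = 0)
    (hint : ∀ t ∈ dom T, ∃ n : ℤ, δ t = n) {t : ℝ} (ht : t ∈ dom T) : δ t = 0 := by
  have hsub : Set.uIcc 0 t ⊆ dom T := by
    rw [Set.uIcc_of_le ht.1]; exact Icc_subset_dom le_rfl ht
  have hivt := intermediate_value_uIcc (hδ.mono hsub)
  obtain ⟨n, hn⟩ := hint t ht
  have key : ∀ m : ℤ, (m : ℝ) + 1 / 2 ∉ Set.uIcc (δ 0) (δ t) := fun m hm => by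
    obtain ⟨s, hs, hs2⟩ := hivt hm
    obtain ⟨k, hk⟩ := hint s (hsub hs)
    rw [hk] at hs2
    have : (2 * k : ℝ) = 2 * m + 1 := by linarith
    have : 2 * k = 2 * m + 1 := by exact_mod_cast this
    omega
  rw [h0, hn] at key
  rcases lt_trichotomy n 0 with h | h | h
  · refine absurd ?_ (key (-1))
    have : (n : ℝ) ≤ -1 := by exact_mod_cast (by omega : n ≤ -1)
    rw [Set.uIcc_of_ge (by linarith)]
    push_cast
    constructor <;> linarith
  · rw [hn, h, Int.cast_zero]
  · refine absurd ?_ (key 0)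
    have : (1 : ℝ) ≤ n := by exact_mod_cast h
    rw [Set.uIcc_of_le (by linarith)]
    push_cast
    constructor <;> linarith

theorem IsPhaseFunction.exists_solution (hT : 0 < T) (hR : Admissible R T) {φ₀ lam : ℝ} {φ : ℝ → ℝ}
    (hφ : IsPhaseFunction R T φ₀ lam φ) :
    HasDensity T φ (fun t => 2 * lam * angleEnergy (R t) (φ t)) ∧
    ∃ (v : ℝ → Fin 2 → ℝ) (r : ℝ → ℝ), IsSystem R T lam v ∧ v 0 = angleVec φ₀ ∧
      ∀ t ∈ dom T, 0 < r t ∧ v t = r t • angleVec (φ t) := by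
  obtain ⟨hcont, hφ0, v, hv, r, hr⟩ := hφ
  have hsys := isSystem_of_tau hR hv.isAC hv.eqn
  have hexp : ∀ θ : ℝ, Complex.exp (Complex.I * (θ : ℂ)) = Real.cos θ + Real.sin θ * Complex.I := by
    intro θ
    rw [mul_comm, Complex.exp_mul_I, Complex.ofReal_cos, Complex.ofReal_sin]
  have hvr : ∀ t ∈ dom T, v t 0 = r t * Real.cos (φ t / 2) ∧ v t 1 = -(r t * Real.sin (φ t / 2)) := by
    intro t ht
    have h := (hr t ht).2
    rw [hexp] at h
    have h1 := congrArg Complex.re h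
    have h2 := congrArg Complex.im h
    simp only [Complex.sub_re, Complex.ofReal_re, Complex.mul_re, Complex.I_re, Complex.I_im,
      Complex.ofReal_im, Complex.add_re, Complex.add_im, Complex.sub_im, Complex.mul_im] at h1 h2
    constructor <;> linarith
  refine ⟨?_, v, r, hsys, hv.init, fun t ht => ⟨(hr t ht).1, ?_⟩⟩
  swap
  · refine funext (Fin.forall_fin_two.2 ⟨?_, ?_⟩)
    · simp [angleVec, (hvr t ht).1]
    · simp [angleVec, (hvr t ht).2]
  have hc : ContinuousOn (fun t => Real.cos (φ t / 2)) (dom T) := by fun_prop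
  have hs : ContinuousOn (fun t => Real.sin (φ t / 2)) (dom T) := by fun_prop
  let κ : ℝ → ℝ := fun t => lam * (R t 0 1 * (Real.cos (φ t / 2) ^ 2 - Real.sin (φ t / 2) ^ 2) +
    (R t 0 0 - R t 1 1) * (Real.cos (φ t / 2) * Real.sin (φ t / 2)))
  let η : ℝ → ℝ := fun t => lam * angleEnergy (R t) (φ t)
  have hκ : ∀ t ∈ dom T, IntervalIntegrable κ volume 0 t := fun t ht => by
    refine IntervalIntegrable.const_mul (((hR.intervalIntegrable_mul
      ((hc.pow 2).sub (hs.pow 2)) 0 1 ht).add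
      ((hR.intervalIntegrable_mul (hc.mul hs) 0 0 ht).sub
      (hR.intervalIntegrable_mul (hc.mul hs) 1 1 ht))).congr fun s _ => ?_) _
    simp
    ring
  have hη : ∀ t ∈ dom T, IntervalIntegrable η volume 0 t := fun t ht =>
    (hR.intervalIntegrable_angleEnergy hcont ht).const_mul lam
  have hκc := (HasDensity.of_integral hκ 0).clm_comp Complex.ofRealCLM
  have hηc := (HasDensity.of_integral hη 0).clm_comp Complex.ofRealCLM
  have hk := hκc.add (hηc.const_mul Complex.I)
  simp only [zero_add, Complex.ofRealCLM_apply] at hk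
  have hF := (hsys.1.clm_comp Complex.ofRealCLM).sub
    ((hsys.2.clm_comp Complex.ofRealCLM).const_mul Complex.I)
  simp only [Complex.ofRealCLM_apply] at hF
  have hF' := hF.congr (g := fun t => ((κ t : ℂ) + Complex.I * (η t : ℂ)) *
      ((v t 0 : ℂ) - Complex.I * (v t 1 : ℂ))) (by
    rw [Filter.EventuallyEq, vol, ae_restrict_iff' measurableSet_dom]
    refine Eventually.of_forall fun t ht => ?_
    obtain ⟨h1, h2⟩ := hvr t ht
    have hsc := Real.sin_sq_add_cos_sq (φ t / 2)
    simp only [κ, η, angleEnergy_eq, h1, h2, RCLike.ofReal_real_eq_id, id]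
    generalize Real.cos (φ t / 2) = c at *
    generalize Real.sin (φ t / 2) = s at *
    apply Complex.ext
    · simp [pow_two]
      linear_combination (-(lam * r t * (R t 0 1 * c - R t 1 1 * s))) * hsc
    · simp [pow_two]
      linear_combination (-(lam * r t * (R t 0 0 * c - R t 0 1 * s))) * hsc)
  have hsol : ∀ t ∈ dom T, ∃ n : ℤ,
      φ t / 2 = φ₀ / 2 + (∫ s in (0 : ℝ)..t, η s) + n * (2 * Real.pi) := fun t ht => by
    have h := HasDensity.eq_mul_cexp hk.1 hF' ht
    have hI := hk.2 t ht
    simp only [intervalIntegral.integral_same, Complex.ofReal_zero, mul_zero, add_zero,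
      zero_add] at hI
    have h0 : (v 0 0 : ℂ) - Complex.I * (v 0 1 : ℂ) =
        Complex.exp (Complex.I * ((φ₀ / 2 : ℝ) : ℂ)) := by
      rw [hexp, hv.init]
      simp [angleVec]
      ring
    have hrt : (r t : ℂ) = Complex.exp (Real.log (r t) : ℝ) := by
      rw [← Complex.ofReal_exp, Real.exp_log (hr t ht).1]
    rw [← hI, h0, (hr t ht).2, hrt, ← Complex.exp_add, ← Complex.exp_add,
      Complex.exp_eq_exp_iff_exists_int] at h
    obtain ⟨n, hn⟩ := h
    refine ⟨n, ?_⟩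
    have := congrArg Complex.im hn
    simp at this
    linarith
  have hηd := HasDensity.of_integral hη 0
  simp only [zero_add] at hηd
  have hδ : ∀ t ∈ dom T, φ t = φ₀ + 2 * ∫ s in (0 : ℝ)..t, η s := fun t ht => by
    have h2 : ContinuousOn (fun t => ∫ s in (0 : ℝ)..t, η s) (dom T) := hηd.continuousOn
    have := eq_zero_of_continuousOn_int (T := T)
      (δ := fun t => ((φ t - φ₀) / 2 - ∫ s in (0 : ℝ)..t, η s) / (2 * Real.pi))
      (by fun_prop) (by simp [hφ0]) (fun t ht => ?_) ht
    · have hpi := Real.pi_pos.ne'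
      field_simp at this
      linarith
    · obtain ⟨n, hn⟩ := hsol t ht
      refine ⟨n, ?_⟩
      rw [div_eq_iff (by positivity)]
      linarith
  have hfin := (HasDensity.const φ₀).add (hηd.const_mul 2)
  refine (hfin.congr_left hT fun t ht => (hδ t ht).symm).congr (Eventually.of_forall fun t => ?_)
  simp only [η]
  ring

end Phase

section Comparison

variable {R : ℝ → Matrix (Fin 2) (Fin 2) ℝ} {T : EReal}

theorem exists_tendsto_of_bounded (hT : 0 < T) (hR : Admissible R T) {lam : ℝ} {φ : ℝ → ℝ}
    (hφ : HasDensity T φ fun t => 2 * lam * angleEnergy (R t) (φ t)) {C : ℝ}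
    (hC : ∀ t ∈ dom T, |φ t| ≤ C) : ∃ L, Tendsto φ (leftOf T) (𝓝 L) := by
  rcases le_total 0 lam with h | h
  · refine exists_tendsto_of_monotoneOn hT (hφ.monotoneOn fun t ht => ?_)
      fun t ht => (le_abs_self _).trans (hC t ht)
    exact mul_nonneg (by linarith) (angleEnergy_pos (hR.posDef t ht) _).le
  · have hmono := hφ.neg.monotoneOn fun t ht => by
      have := mul_nonneg (by linarith : 0 ≤ -(2 * lam)) (angleEnergy_pos (hR.posDef t ht) (φ t)).le
      linarith
    obtain ⟨L, hL⟩ := exists_tendsto_of_monotoneOn hT hmono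
      fun t ht => (neg_le_abs _).trans (hC t ht)
    exact ⟨-L, by simpa using hL.neg⟩

theorem LimitCircle.exists_tendsto_phase (hLC : LimitCircle R T) (hT : 0 < T) (hR : Admissible R T)
    {lam : ℝ} {φ : ℝ → ℝ} (hφ : HasDensity T φ fun t => 2 * lam * angleEnergy (R t) (φ t)) :
    ∃ L, Tendsto φ (leftOf T) (𝓝 L) := by
  refine exists_tendsto_of_bounded hT hR hφ
    (C := |φ 0| + 2 * |lam| * ∫ s, entrySum (R s) ∂(vol T)) fun t ht => ?_
  rw [hφ.2 t ht]
  refine (abs_add_le _ _).trans (add_le_add le_rfl ?_)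
  refine hLC.abs_integral_le hR (by positivity) (fun s hs => ?_) ht
  rw [abs_mul, abs_mul, abs_two, abs_of_pos (angleEnergy_pos (hR.posDef s hs) _)]
  exact mul_le_mul_of_nonneg_left (angleEnergy_le _ _) (by positivity)

theorem exists_integratingFactor (hR : Admissible R T) {lam μ : ℝ} {φ ψ : ℝ → ℝ}
    (hφ : HasDensity T φ fun t => 2 * lam * angleEnergy (R t) (φ t))
    (hψ : HasDensity T ψ fun t => 2 * μ * angleEnergy (R t) (ψ t)) :
    ∃ κ : ℝ → ℝ, (∀ t, |κ t| ≤ 2 * |lam| * entrySum (R t)) ∧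
      HasDensity T (fun t => (ψ t - φ t) * Real.exp (-∫ s in (0 : ℝ)..t, κ s))
        fun t => 2 * (μ - lam) * angleEnergy (R t) (ψ t) * Real.exp (-∫ s in (0 : ℝ)..t, κ s) := by
  let κ : ℝ → ℝ := fun t =>
    2 * lam * (angleEnergy (R t) (ψ t) - angleEnergy (R t) (φ t)) / (ψ t - φ t)
  have hκ : ∀ t, |κ t| ≤ 2 * |lam| * entrySum (R t) := fun t => by
    simp only [κ, abs_div, abs_mul, abs_two]
    refine div_le_of_le_mul₀ (abs_nonneg _) (mul_nonneg (by positivity) (entrySum_nonneg _)) ?_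
    rw [mul_assoc (2 * |lam|)]
    exact mul_le_mul_of_nonneg_left (abs_angleEnergy_sub_le _ _ _) (by positivity)
  refine ⟨κ, hκ, HasDensity.mul_exp_neg (fun t ht => ?_)
    ((hψ.sub hφ).congr (Eventually.of_forall fun t => ?_))⟩
  · refine hR.intervalIntegrable_of_le (fun s _ => hκ s) ht ?_
    have h1 := ((hR.intervalIntegrable_angleEnergy hψ.continuousOn ht).sub
      (hR.intervalIntegrable_angleEnergy hφ.continuousOn ht)).const_mul (2 * lam)
    have h2 := ((hψ.sub hφ).continuousOn.mono fun x (hx : x ∈ Set.Ioc 0 t) =>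
      Icc_subset_dom le_rfl ht ⟨hx.1.le, hx.2⟩).aestronglyMeasurable (μ := volume) measurableSet_Ioc
    exact (h1.1.aestronglyMeasurable.aemeasurable.div h2.aemeasurable).aestronglyMeasurable
  · simp only [κ]
    by_cases h : ψ t - φ t = 0
    · rw [sub_eq_zero.1 h]
      ring
    · rw [div_mul_cancel₀ _ h]
      ring

theorem LimitCircle.exists_lipschitz (hLC : LimitCircle R T) (hR : Admissible R T)
    (lam : ℝ) : ∃ C : ℝ, ∀ (μ : ℝ) (φ ψ : ℝ → ℝ),
      HasDensity T φ (fun t => 2 * lam * angleEnergy (R t) (φ t)) →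
      HasDensity T ψ (fun t => 2 * μ * angleEnergy (R t) (ψ t)) → φ 0 = ψ 0 →
      ∀ t ∈ dom T, |ψ t - φ t| ≤ C * |μ - lam| := by
  set K := ∫ s, entrySum (R s) ∂(vol T)
  refine ⟨2 * Real.exp (2 * |lam| * K) * K * Real.exp (2 * |lam| * K),
    fun μ φ ψ hφ hψ h0 t ht => ?_⟩
  obtain ⟨κ, hκ, hD⟩ := exists_integratingFactor hR hφ hψ
  have hE : ∀ t ∈ dom T, |∫ s in (0 : ℝ)..t, κ s| ≤ 2 * |lam| * K := fun t ht =>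
    hLC.abs_integral_le hR (by positivity) (fun t _ => hκ t) ht
  have h1 := hD.2 t ht
  rw [h0, sub_self, zero_mul, zero_add] at h1
  have h2 : |(ψ t - φ t) * Real.exp (-∫ s in (0 : ℝ)..t, κ s)| ≤
      2 * |μ - lam| * Real.exp (2 * |lam| * K) * K := by
    rw [h1]
    refine hLC.abs_integral_le hR (by positivity) (fun s hs => ?_) ht
    rw [abs_mul, abs_mul, abs_mul, abs_two, Real.abs_exp,
      abs_of_pos (angleEnergy_pos (hR.posDef s hs) _)]
    have h3 : Real.exp (-∫ s in (0 : ℝ)..s, κ s) ≤ Real.exp (2 * |lam| * K) :=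
      Real.exp_le_exp.2 (by linarith [neg_le_of_abs_le (hE s hs)])
    calc _ ≤ 2 * |μ - lam| * entrySum (R s) * Real.exp (2 * |lam| * K) := by
          gcongr
          · exact mul_nonneg (by positivity) (entrySum_nonneg _)
          · exact angleEnergy_le _ _
      _ = _ := by ring
  rw [abs_mul, Real.abs_exp] at h2
  have h3 : Real.exp (∫ s in (0 : ℝ)..t, κ s) ≤ Real.exp (2 * |lam| * K) :=
    Real.exp_le_exp.2 (by linarith [le_of_abs_le (hE t ht)])
  calc |ψ t - φ t| = |ψ t - φ t| * Real.exp (-∫ s in (0 : ℝ)..t, κ s) *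
        Real.exp (∫ s in (0 : ℝ)..t, κ s) := by rw [mul_assoc, ← Real.exp_add]; simp
    _ ≤ (2 * |μ - lam| * Real.exp (2 * |lam| * K) * K) * Real.exp (2 * |lam| * K) :=
      mul_le_mul h2 h3 (Real.exp_pos _).le ((by positivity : (0:ℝ) ≤ _).trans h2)
    _ = _ := by ring

theorem LimitCircle.exists_gap (hLC : LimitCircle R T) (hT : 0 < T) (hR : Admissible R T)
    {lam μ : ℝ} (hlt : lam < μ) {φ ψ : ℝ → ℝ}
    (hφ : HasDensity T φ fun t => 2 * lam * angleEnergy (R t) (φ t))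
    (hψ : HasDensity T ψ fun t => 2 * μ * angleEnergy (R t) (ψ t)) (h0 : φ 0 = ψ 0) :
    ∃ c > 0, ∀ᶠ t in leftOf T, φ t + c ≤ ψ t := by
  set K := ∫ s, entrySum (R s) ∂(vol T)
  obtain ⟨κ, hκ, hD⟩ := exists_integratingFactor hR hφ hψ
  have hE : ∀ t ∈ dom T, |∫ s in (0 : ℝ)..t, κ s| ≤ 2 * |lam| * K := fun t ht =>
    hLC.abs_integral_le hR (by positivity) (fun t _ => hκ t) ht
  obtain ⟨q, hq0, hq⟩ := exists_gt_mem_dom (zero_mem_dom hT)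
  have hpos : ∀ t ∈ dom T, 0 < 2 * (μ - lam) * angleEnergy (R t) (ψ t) *
      Real.exp (-∫ s in (0 : ℝ)..t, κ s) := fun t ht => by
    have := angleEnergy_pos (hR.posDef t ht) (ψ t)
    have := sub_pos.2 hlt
    positivity
  have hmono := hD.monotoneOn fun t ht => (hpos t ht).le
  set G : ℝ → ℝ := fun t => (ψ t - φ t) * Real.exp (-∫ s in (0 : ℝ)..t, κ s) with hG
  have hGq : 0 < G q := by
    have h1 : G 0 = 0 := by simp [hG, h0]
    rw [hD.2 q hq, h1, zero_add]
    exact intervalIntegral.intervalIntegral_pos_of_pos_on (hD.1 q hq)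
      (fun x hx => hpos x (Icc_subset_dom le_rfl hq ⟨hx.1.le, hx.2.le⟩)) hq0
  refine ⟨G q * Real.exp (-(2 * |lam| * K)), by positivity, ?_⟩
  filter_upwards [eventually_leftOf hq] with t ht
  have h1 : G q ≤ G t := hmono hq ht.2 ht.1.le
  have h2 : ψ t - φ t = G t * Real.exp (∫ s in (0 : ℝ)..t, κ s) := by
    simp only [hG]; rw [mul_assoc, ← Real.exp_add]; simp
  have h3 : Real.exp (-(2 * |lam| * K)) ≤ Real.exp (∫ s in (0 : ℝ)..t, κ s) :=
    Real.exp_le_exp.2 (neg_le_of_abs_le (hE t ht.2))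
  have h4 := mul_le_mul h1 h3 (Real.exp_pos _).le (hGq.le.trans h1)
  linarith

theorem LimitCircle.continuous_and_strictMono (hLC : LimitCircle R T) (hT : 0 < T)
    (hR : Admissible R T) {φ : ℝ → ℝ → ℝ}
    (hφ : ∀ lam, HasDensity T (φ lam) fun t => 2 * lam * angleEnergy (R t) (φ lam t))
    (h0 : ∀ lam μ, φ lam 0 = φ μ 0) {Φ : ℝ → ℝ}
    (hΦ : ∀ lam, Tendsto (φ lam) (leftOf T) (𝓝 (Φ lam))) : Continuous Φ ∧ StrictMono Φ := by
  have := leftOf_neBot hT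
  constructor
  · refine continuous_iff_continuousAt.2 fun lam => ?_
    obtain ⟨C, hC⟩ := hLC.exists_lipschitz hR lam
    have hle : ∀ μ, |Φ μ - Φ lam| ≤ C * |μ - lam| := fun μ => by
      refine le_of_tendsto ((hΦ μ).sub (hΦ lam)).abs ?_
      filter_upwards [eventually_leftOf (zero_mem_dom hT)] with t ht
      exact hC μ _ _ (hφ lam) (hφ μ) (h0 _ _) t ht.2
    refine tendsto_iff_dist_tendsto_zero.2 (squeeze_zero (fun _ => dist_nonneg) hle ?_)
    have : Continuous fun μ => C * |μ - lam| := by fun_prop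
    simpa using this.tendsto lam
  · intro lam μ hlt
    obtain ⟨c, hc, hev⟩ := hLC.exists_gap hT hR hlt (hφ lam) (hφ μ) (h0 _ _)
    have := le_of_tendsto_of_tendsto ((hΦ lam).add_const c) (hΦ μ) hev
    linarith

end Comparison

section Parallel

variable {𝕜 : Type*} [RCLike 𝕜]

theorem wronskian_eq (v : Fin 2 → 𝕜) (u : Fin 2 → ℝ) :
    wronskian v u = v 1 * (u 0 : 𝕜) - v 0 * (u 1 : 𝕜) := by
  simp [wronskian, J, Matrix.mulVec, dotProduct, Fin.sum_univ_two]
  ring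

theorem wronskian_ofReal (v u : Fin 2 → ℝ) :
    wronskian (fun i => (v i : 𝕜)) u = ((wronskian v u : ℝ) : 𝕜) := by
  simp [wronskian_eq]

theorem wronskian_smul (c : 𝕜) (v : Fin 2 → 𝕜) (u : Fin 2 → ℝ) :
    wronskian (c • v) u = c * wronskian v u := by
  simp [wronskian_eq]
  ring

theorem wronskian_smul_right (c : ℝ) (v : Fin 2 → 𝕜) (u : Fin 2 → ℝ) :
    wronskian v (c • u) = c * wronskian v u := by
  simp [wronskian_eq]
  ring

theorem parallel_iff (a b : Fin 2 → ℝ) : Parallel a b ↔ wronskian a b = 0 := by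
  simp [Parallel, wronskian]

theorem exists_eq_smul_angleVec {w : Fin 2 → 𝕜} {x : ℝ} (h : wronskian w (angleVec x) = 0) :
    ∃ c : 𝕜, w = c • fun i => (angleVec x i : 𝕜) := by
  rw [wronskian_eq] at h
  have hsc : (Real.sin (x / 2) : 𝕜) ^ 2 + (Real.cos (x / 2) : 𝕜) ^ 2 = 1 := by
    exact_mod_cast congrArg (RCLike.ofReal (K := 𝕜)) (Real.sin_sq_add_cos_sq (x / 2))
  refine ⟨w 0 * (angleVec x 0 : 𝕜) + w 1 * (angleVec x 1 : 𝕜),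
    funext (Fin.forall_fin_two.2 ⟨?_, ?_⟩)⟩ <;>
  · simp only [angleVec, Matrix.cons_val_zero, Matrix.cons_val_one, Pi.smul_apply, smul_eq_mul,
      RCLike.ofReal_neg] at h ⊢
    generalize (Real.sin (x / 2) : 𝕜) = s at *
    generalize (Real.cos (x / 2) : 𝕜) = c at *
    first
    | linear_combination (-(w 0)) * hsc + s * h
    | linear_combination (-(w 1)) * hsc + c * h

theorem exists_angleVec_of_parallel {u : Fin 2 → ℝ} (hu : u ≠ 0) {x : ℝ}
    (h : Parallel u (angleVec x)) : ∃ c : ℝ, c ≠ 0 ∧ u = c • angleVec x := by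
  obtain ⟨c, hc⟩ := exists_eq_smul_angleVec (𝕜 := ℝ) ((parallel_iff _ _).1 h)
  refine ⟨c, fun h0 => hu ?_, hc⟩
  rw [hc, h0, zero_smul]

theorem wronskian_eq_zero_iff {u : Fin 2 → ℝ} (hu : u ≠ 0) {x : ℝ} (h : Parallel u (angleVec x))
    (w : Fin 2 → 𝕜) : wronskian w u = 0 ↔ wronskian w (angleVec x) = 0 := by
  obtain ⟨c, hc, rfl⟩ := exists_angleVec_of_parallel hu h
  rw [wronskian_smul_right]
  simp [hc]

theorem wronskian_angleVec (x y : ℝ) :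
    wronskian (angleVec x) (angleVec y) = Real.sin ((y - x) / 2) := by
  rw [sub_div, Real.sin_sub, wronskian_eq]
  simp [angleVec]
  ring

theorem wronskian_angleVec_eq_zero_iff {x y : ℝ} :
    wronskian (angleVec x) (angleVec y) = 0 ↔ ∃ k : ℤ, x = y + 2 * Real.pi * k := by
  rw [wronskian_angleVec, Real.sin_eq_zero_iff]
  constructor
  · rintro ⟨n, hn⟩
    exact ⟨-n, by push_cast; linarith⟩
  · rintro ⟨k, rfl⟩
    exact ⟨-k, by push_cast; ring⟩

theorem continuous_wronskian_angleVec (u : Fin 2 → ℝ) :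
    Continuous fun x => wronskian (angleVec x) u := by
  simp only [wronskian_eq, angleVec, Matrix.cons_val_zero, Matrix.cons_val_one]
  fun_prop

/-- The skew form `w* J w`. -/
def skew (w : Fin 2 → 𝕜) : 𝕜 := star (w 1) * w 0 - star (w 0) * w 1

theorem norm_skew_le (w : Fin 2 → 𝕜) (u : Fin 2 → ℝ) :
    (|u 0| + |u 1|) * ‖skew w‖ ≤ 2 * ‖wronskian w u‖ * (normSq w + 1) := by
  set W := wronskian w u with hW
  rw [wronskian_eq] at hW
  have h0 : (u 0 : 𝕜) * skew w = star W * w 0 - star (w 0) * W := by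
    rw [hW, skew]; simp; ring
  have h1 : (u 1 : 𝕜) * skew w = star W * w 1 - star (w 1) * W := by
    rw [hW, skew]; simp; ring
  have b0 := norm_sub_le (star W * w 0) (star (w 0) * W)
  have b1 := norm_sub_le (star W * w 1) (star (w 1) * W)
  rw [← h0] at b0
  rw [← h1] at b1
  simp only [norm_mul, norm_star, RCLike.norm_ofReal] at b0 b1
  have h3 : ‖w 0‖ + ‖w 1‖ ≤ normSq w + 1 := by
    unfold normSq; nlinarith [sq_nonneg (‖w 0‖ - 1), sq_nonneg (‖w 1‖ - 1)]
  have h4 := mul_le_mul_of_nonneg_left h3 (norm_nonneg W)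
  linarith

theorem quad_smul (A : Matrix (Fin 2) (Fin 2) ℝ) (c : 𝕜) (w : Fin 2 → 𝕜) :
    quad A (c • w) = ‖c‖ ^ 2 * quad A w := by
  have h : star (c * w 0) * (c * w 1) = ((‖c‖ ^ 2 : ℝ) : 𝕜) * (star (w 0) * w 1) := by
    have := RCLike.conj_mul c
    rw [star_mul']
    simp only [RCLike.star_def, RCLike.ofReal_pow] at this ⊢
    linear_combination (starRingEnd 𝕜 (w 0) * w 1) * this
  simp only [quad, Pi.smul_apply, smul_eq_mul, h, RCLike.re_ofReal_mul, norm_mul]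
  ring

theorem quad_ofReal (A : Matrix (Fin 2) (Fin 2) ℝ) (v : Fin 2 → ℝ) :
    quad A (fun i => (v i : 𝕜)) = quad A v := by
  simp [quad]

theorem normSq_smul (c : 𝕜) (w : Fin 2 → 𝕜) : normSq (c • w) = ‖c‖ ^ 2 * normSq w := by
  simp [normSq, mul_pow]
  ring

end Parallel

section MemL2

variable {𝕜 : Type*} [RCLike 𝕜] {R : ℝ → Matrix (Fin 2) (Fin 2) ℝ} {T : EReal}

theorem Admissible.ae_posDef (hR : Admissible R T) : ∀ᵐ t ∂(vol T), (R t).PosDef :=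
  (ae_restrict_iff' measurableSet_dom).2 (Eventually.of_forall hR.posDef)

theorem Admissible.aestronglyMeasurable_quad (hR : Admissible R T) {w : ℝ → Fin 2 → 𝕜}
    (hw : AEStronglyMeasurable w (vol T)) :
    AEStronglyMeasurable (fun t => quad (R t) (w t)) (vol T) := by
  have h0 : AEStronglyMeasurable (fun t => w t 0) (vol T) :=
    (continuous_apply 0).comp_aestronglyMeasurable hw
  have h1 : AEStronglyMeasurable (fun t => w t 1) (vol T) :=
    (continuous_apply 1).comp_aestronglyMeasurable hw
  have h2 : AEStronglyMeasurable (fun t => RCLike.re (star (w t 0) * w t 1)) (vol T) :=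
    RCLike.continuous_re.comp_aestronglyMeasurable (h0.star.mul h1)
  unfold quad
  exact (((hR.measurable 0 0).mul (h0.norm.pow 2)).add
    (((hR.measurable 0 1).const_mul 2).mul h2)).add ((hR.measurable 1 1).mul (h1.norm.pow 2))

theorem Admissible.intervalIntegrable_quad (hR : Admissible R T) {w : ℝ → Fin 2 → 𝕜}
    (hw : ContinuousOn w (dom T)) {t : ℝ} (ht : t ∈ dom T) :
    IntervalIntegrable (fun s => quad (R s) (w s)) volume 0 t := by
  have c0 : ContinuousOn (fun t => w t 0) (dom T) := (continuous_apply 0).comp_continuousOn hw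
  have c1 : ContinuousOn (fun t => w t 1) (dom T) := (continuous_apply 1).comp_continuousOn hw
  have c2 : ContinuousOn (fun t => RCLike.re (star (w t 0) * w t 1)) (dom T) :=
    RCLike.continuous_re.comp_continuousOn (c0.star.mul c1)
  refine (((hR.intervalIntegrable_mul (c0.norm.pow 2) 0 0 ht).add
    ((hR.intervalIntegrable_mul c2 0 1 ht).const_mul 2)).add
    (hR.intervalIntegrable_mul (c1.norm.pow 2) 1 1 ht)).congr fun s _ => ?_
  simp [quad]
  ring

theorem memL2_iff (hR : Admissible R T) {w : ℝ → Fin 2 → 𝕜} :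
    MemL2 R T w ↔ AEStronglyMeasurable w (vol T) ∧
      Integrable (fun t => quad (R t) (w t)) (vol T) := by
  have h : pairing R w w =ᵐ[vol T] fun t => ((quad (R t) (w t) : ℝ) : 𝕜) := by
    filter_upwards [hR.ae_posDef] with t ht using pairing_self ht w
  rw [MemL2, integrable_congr h]
  refine and_congr_right fun _ => ⟨fun h => ?_, fun h => h.ofReal⟩
  simpa using h.re

theorem MemL2.congr (hR : Admissible R T) {v w : ℝ → Fin 2 → 𝕜} (hv : MemL2 R T v)
    (h : v =ᵐ[vol T] w) : MemL2 R T w := by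
  rw [memL2_iff hR] at hv ⊢
  refine ⟨hv.1.congr h, hv.2.congr ?_⟩
  filter_upwards [h] with t ht
  rw [ht]

theorem MemL2.const_smul (hR : Admissible R T) {w : ℝ → Fin 2 → 𝕜} (hw : MemL2 R T w) (c : 𝕜) :
    MemL2 R T fun t => c • w t := by
  rw [memL2_iff hR] at hw ⊢
  refine ⟨hw.1.const_smul c, ?_⟩
  simp only [quad_smul]
  exact hw.2.const_mul _

theorem constMemL2_iff (hR : Admissible R T) (u : Fin 2 → ℝ) :
    ConstMemL2 R T u ↔ Integrable (fun t => quad (R t) u) (vol T) := by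
  refine integrable_congr ?_
  filter_upwards [hR.ae_posDef] with x hx
  have h1 := pairing_self (R := R) (t := x) hx fun _ => u
  simpa only [pairing, RCLike.ofReal_real_eq_id, id_eq, star_trivial, Matrix.map_id] using h1

theorem innerL2_self (hR : Admissible R T) (w : ℝ → Fin 2 → 𝕜) :
    innerL2 R T w w = ((∫ t, quad (R t) (w t) ∂(vol T) : ℝ) : 𝕜) := by
  rw [innerL2, ← integral_ofReal]
  refine integral_congr_ae ?_
  filter_upwards [hR.ae_posDef] with t ht using pairing_self ht w

end MemL2

section Eigenvalue

variable {𝕜 : Type*} [RCLike 𝕜] {R : ℝ → Matrix (Fin 2) (Fin 2) ℝ} {T : EReal}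
  {u₀ u₁ : Fin 2 → ℝ}

theorem LimitCircle.isEigenvalue_of_isSystem (hLC : LimitCircle R T) (hT : 0 < T)
    (hR : Admissible R T) {μ : 𝕜} {w : ℝ → Fin 2 → 𝕜} (hw : IsSystem R T μ w) (h0 : w 0 ≠ 0)
    (hleft : wronskian (w 0) u₀ = 0)
    (hright : Tendsto (fun s => wronskian (w s) u₁) (leftOf T) (𝓝 0)) :
    IsEigenvalue R T u₀ u₁ μ := by
  have hmem : MemL2 R T w := by
    rw [memL2_iff hR]
    have hm := hw.continuousOn.aestronglyMeasurable (μ := volume) measurableSet_dom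
    refine ⟨hm, ?_⟩
    obtain ⟨C, hC⟩ := hw.normSq_le hR hLC
    refine Integrable.mono' (hLC.integrable_entrySum.const_mul C) (hR.aestronglyMeasurable_quad hm) ?_
    rw [vol, ae_restrict_iff' measurableSet_dom]
    refine Eventually.of_forall fun t ht => ?_
    rw [Real.norm_of_nonneg (quad_nonneg (hR.posDef t ht) _), mul_comm]
    exact (quad_le _ _).trans (mul_le_mul_of_nonneg_left (hC t ht) (entrySum_nonneg _))
  have htau := hw.tau_eq hR
  exact ⟨w, ⟨hmem, hw.isAC, (hmem.const_smul hR μ).congr hR htau.symm, hleft, fun _ => hright⟩,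
    ⟨0, zero_mem_dom hT, h0⟩, htau⟩

theorem IsEigenvalue.exists_isSystem (hR : Admissible R T) {μ : 𝕜}
    (h : IsEigenvalue R T u₀ u₁ μ) : ∃ w : ℝ → Fin 2 → 𝕜, IsSystem R T μ w ∧ w 0 ≠ 0 ∧
      wronskian (w 0) u₀ = 0 ∧
      (LimitCircle R T → Tendsto (fun s => wronskian (w s) u₁) (leftOf T) (𝓝 0)) := by
  obtain ⟨w, hw, ⟨t, ht, hne⟩, htau⟩ := h
  have hsys := isSystem_of_tau hR hw.isAC htau
  exact ⟨w, hsys, fun h0 => hne (hsys.eq_zero hR h0 ht), hw.left_bc, hw.right_bc⟩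

theorem IsSystem.hasDensity_skew {μ : 𝕜} {w : ℝ → Fin 2 → 𝕜} (hw : IsSystem R T μ w) :
    HasDensity T (fun t => skew (w t)) fun t => (μ - star μ) * ((quad (R t) (w t) : ℝ) : 𝕜) := by
  refine ((hw.2.star.mul hw.1).sub (hw.1.star.mul hw.2)).congr (Eventually.of_forall fun t => ?_)
  have hre : ((RCLike.re (star (w t 0) * w t 1) : ℝ) : 𝕜) =
      (star (w t 0) * w t 1 + star (w t 1) * w t 0) / 2 := by
    rw [RCLike.re_eq_add_conj]
    simp
    ring
  have h0 : ((‖w t 0‖ ^ 2 : ℝ) : 𝕜) = star (w t 0) * w t 0 := by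
    simp [RCLike.conj_mul]
  have h1 : ((‖w t 1‖ ^ 2 : ℝ) : 𝕜) = star (w t 1) * w t 1 := by
    simp [RCLike.conj_mul]
  have h2 : ((2 : ℝ) : 𝕜) = 2 := RCLike.ofReal_ofNat 2
  simp only [quad, RCLike.ofReal_add, RCLike.ofReal_mul, hre, h0, h1, h2]
  simp
  ring

theorem IsEigenvalue.exists_real (hLC : LimitCircle R T) (hT : 0 < T) (hR : Admissible R T)
    (hu₀ : u₀ ≠ 0) (hu₁ : u₁ ≠ 0) {μ : 𝕜} (h : IsEigenvalue R T u₀ u₁ μ) :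
    ∃ lam : ℝ, μ = lam := by
  have := leftOf_neBot hT
  obtain ⟨w, hw, h0, hl, hr⟩ := h.exists_isSystem hR
  have hpos : ∀ u : Fin 2 → ℝ, u ≠ 0 → 0 < |u 0| + |u 1| := fun u hu => by
    by_contra hcon
    refine hu (funext (Fin.forall_fin_two.2 ⟨?_, ?_⟩)) <;>
    · refine abs_eq_zero.1 (le_antisymm ?_ (abs_nonneg _))
      linarith [abs_nonneg (u 0), abs_nonneg (u 1)]
  have hskew0 : skew (w 0) = 0 := by
    have := norm_skew_le (w 0) u₀
    rw [hl, norm_zero, mul_zero, zero_mul] at this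
    have := nonpos_of_mul_nonpos_right this (hpos _ hu₀)
    exact norm_le_zero_iff.1 this
  obtain ⟨C, hC⟩ := hw.normSq_le hR hLC
  have hlim : Tendsto (fun t => (|u₁ 0| + |u₁ 1|) * ‖skew (w t)‖) (leftOf T) (𝓝 0) := by
    have h1 := (((hr hLC).norm.const_mul 2).mul_const (C + 1))
    rw [norm_zero, mul_zero, zero_mul] at h1
    refine squeeze_zero' (Eventually.of_forall fun t => by positivity) ?_ h1
    filter_upwards [eventually_leftOf (zero_mem_dom hT)] with t ht
    refine (norm_skew_le _ _).trans (mul_le_mul_of_nonneg_left ?_ (by positivity))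
    linarith [hC t ht.2]
  have hq := fun t (ht : t ∈ dom T) => hR.intervalIntegrable_quad hw.continuousOn ht
  have hQ := HasDensity.of_integral hq 0
  simp only [zero_add] at hQ
  have hmono := hQ.monotoneOn fun t ht => quad_nonneg (hR.posDef t ht) _
  have hnorm : ∀ t ∈ dom T, ‖skew (w t)‖ = ‖μ - star μ‖ * ∫ s in (0 : ℝ)..t, quad (R s) (w s) := by
    intro t ht
    have h1 := hw.hasDensity_skew.2 t ht
    have h2 := (RCLike.ofRealCLM (K := 𝕜)).intervalIntegral_comp_comm (hq t ht)
    simp only [RCLike.ofRealCLM_apply] at h2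
    rw [hskew0, zero_add, intervalIntegral.integral_const_mul, h2] at h1
    rw [h1, norm_mul, RCLike.norm_ofReal, abs_of_nonneg]
    exact intervalIntegral.integral_nonneg ht.1 fun x hx =>
      quad_nonneg (hR.posDef x (Icc_subset_dom le_rfl ht hx)) _
  obtain ⟨q, hq0, hqd⟩ := exists_gt_mem_dom (zero_mem_dom hT)
  have hQpos : 0 < ∫ s in (0 : ℝ)..q, quad (R s) (w s) := by
    refine intervalIntegral.intervalIntegral_pos_of_pos_on (hq q hqd) (fun x hx => ?_) hq0
    have hxd := Icc_subset_dom le_rfl hqd ⟨hx.1.le, hx.2.le⟩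
    refine quad_pos (hR.posDef x hxd) fun hx0 => ?_
    obtain ⟨c, hc, hle⟩ := hw.le_normSq hR hLC h0
    have := hle x hxd
    rw [normSq_eq_zero.2 hx0] at this
    linarith
  have hle : (|u₁ 0| + |u₁ 1|) * (‖μ - star μ‖ * ∫ s in (0 : ℝ)..q, quad (R s) (w s)) ≤ 0 := by
    refine ge_of_tendsto hlim ?_
    filter_upwards [eventually_leftOf hqd] with t ht
    rw [hnorm t ht.2]
    have := hmono hqd ht.2 ht.1.le
    simp only at this
    gcongr
  have h1 := nonpos_of_mul_nonpos_right hle (hpos _ hu₁)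
  have h2 := nonpos_of_mul_nonpos_left h1 hQpos
  have h3 := sub_eq_zero.1 (norm_le_zero_iff.1 h2)
  obtain ⟨r, hr⟩ := RCLike.conj_eq_iff_real.1 h3.symm
  exact ⟨r, hr⟩

theorem LimitCircle.isEigenvalue_iff (hLC : LimitCircle R T) (hT : 0 < T) (hR : Admissible R T)
    (hu₀ : u₀ ≠ 0) (hu₁ : u₁ ≠ 0) {φ₀ φ₁ : ℝ} (hp₀ : Parallel u₀ (angleVec φ₀))
    (hp₁ : Parallel u₁ (angleVec φ₁)) {lam : ℝ} {φ r : ℝ → ℝ} {v : ℝ → Fin 2 → ℝ}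
    (hv : IsSystem R T lam v) (hv0 : v 0 = angleVec φ₀)
    (hr : ∀ t ∈ dom T, 0 < r t ∧ v t = r t • angleVec (φ t)) {L : ℝ}
    (hL : Tendsto φ (leftOf T) (𝓝 L)) :
    IsEigenvalue R T u₀ u₁ (lam : 𝕜) ↔ ∃ k : ℤ, L = φ₁ + 2 * Real.pi * k := by
  have := leftOf_neBot hT
  have hvK : IsSystem R T (lam : 𝕜) fun t i => (v t i : 𝕜) := hv.ofReal
  have hWlim := ((continuous_wronskian_angleVec u₁).tendsto L).comp hL
  have hrsq : ∀ t ∈ dom T, normSq (v t) = r t ^ 2 := fun t ht => by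
    rw [(hr t ht).2, normSq_smul, normSq_angleVec, mul_one, Real.norm_eq_abs, sq_abs]
  have hWr : ∀ t ∈ dom T, wronskian (v t) u₁ = r t * wronskian (angleVec (φ t)) u₁ := fun t ht => by
    rw [(hr t ht).2, wronskian_smul]
  rw [← wronskian_angleVec_eq_zero_iff, ← wronskian_eq_zero_iff hu₁ hp₁]
  constructor
  · intro h
    obtain ⟨w, hw, h0, hl, hright⟩ := h.exists_isSystem hR
    obtain ⟨d, hd⟩ := exists_eq_smul_angleVec ((wronskian_eq_zero_iff hu₀ hp₀ _).1 hl)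
    have hd0 : d ≠ 0 := fun h => h0 (by rw [hd, h, zero_smul])
    have hwv : ∀ t ∈ dom T, w t = d • fun i => (v t i : 𝕜) := fun t ht => by
      refine sub_eq_zero.1 ((hw.sub_smul hvK d).eq_zero hR ?_ ht)
      rw [hd, hv0, sub_self]
    obtain ⟨c, hc, hle⟩ := hv.le_normSq hR hLC (by rw [hv0]; exact angleVec_ne_zero _)
    have h1 : Tendsto (fun t => ‖d‖ * Real.sqrt c * |wronskian (angleVec (φ t)) u₁|) (leftOf T)
        (𝓝 0) := by
      refine squeeze_zero' (Eventually.of_forall fun t => by positivity) ?_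
        (by simpa using (hright hLC).norm)
      filter_upwards [eventually_leftOf (zero_mem_dom hT)] with t ht
      rw [hwv t ht.2, wronskian_smul, wronskian_ofReal, norm_mul, RCLike.norm_ofReal, hWr t ht.2,
        abs_mul, mul_assoc]
      have : Real.sqrt c ≤ |r t| := Real.sqrt_le_iff.2 ⟨abs_nonneg _, by
        rw [sq_abs, ← hrsq t ht.2]; exact hle t ht.2⟩
      gcongr
    have h2 := tendsto_nhds_unique h1 (hWlim.abs.const_mul _)
    have h3 : ‖d‖ * Real.sqrt c ≠ 0 := by
      have := Real.sqrt_pos.2 hc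
      have := norm_pos_iff.2 hd0
      positivity
    exact abs_eq_zero.1 ((mul_eq_zero.1 h2.symm).resolve_left h3)
  · intro h
    refine hLC.isEigenvalue_of_isSystem hT hR hvK ?_ ?_ ?_
    · intro h0
      refine angleVec_ne_zero φ₀ (funext fun i => ?_)
      have := congrFun h0 i
      rw [hv0] at this
      simpa using this
    · rw [wronskian_eq_zero_iff hu₀ hp₀, hv0, wronskian_ofReal,
        wronskian_angleVec_eq_zero_iff.2 ⟨0, by simp⟩, RCLike.ofReal_zero]
    · obtain ⟨C, hC⟩ := hv.normSq_le hR hLC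
      rw [h] at hWlim
      have hlim := hWlim.abs.const_mul (Real.sqrt C)
      rw [abs_zero, mul_zero] at hlim
      refine squeeze_zero_norm' ?_ hlim
      filter_upwards [eventually_leftOf (zero_mem_dom hT)] with t ht
      rw [wronskian_ofReal, RCLike.norm_ofReal, hWr t ht.2, abs_mul]
      have : |r t| ≤ Real.sqrt C := Real.abs_le_sqrt (by rw [← hrsq t ht.2]; exact hC t ht.2)
      exact mul_le_mul_of_nonneg_right this (abs_nonneg _)

end Eigenvalue

section TestFunction

variable {𝕜 : Type*} [RCLike 𝕜] {R : ℝ → Matrix (Fin 2) (Fin 2) ℝ} {T : EReal}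
  {u₀ u₁ : Fin 2 → ℝ}

theorem HasDensity.clamp {E : Type*} [NormedAddCommGroup E] [NormedSpace ℝ E] {F f : ℝ → E}
    (hF : HasDensity T F f) {s t : ℝ} (hs : s ∈ dom T) (ht : t ∈ dom T) (hst : s ≤ t) :
    HasDensity T (fun x => F (max s (min x t))) ((Set.Ioc s t).indicator f) := by
  have hint : IntegrableOn f (Set.Ioc s t) := (hF.intervalIntegrable hs ht).1
  have hind : Integrable ((Set.Ioc s t).indicator f) volume :=
    (integrable_indicator_iff measurableSet_Ioc).2 hint
  refine ⟨fun x _ => hind.intervalIntegrable, fun x hx => ?_⟩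
  have h0 : max s (min 0 t) = s := by rw [min_eq_left ht.1, max_eq_left hs.1]
  have hmem : max s (min x t) ∈ dom T :=
    Icc_subset_dom hs.1 ht ⟨le_max_left _ _, max_le hst (min_le_right _ _)⟩
  rw [h0, ← sub_eq_iff_eq_add', hF.sub_eq hs hmem, intervalIntegral.integral_of_le (le_max_left _ _),
    intervalIntegral.integral_of_le hx.1, setIntegral_indicator measurableSet_Ioc]
  congr 2
  ext y
  have := hs.1
  simp only [Set.mem_Ioc, Set.mem_inter_iff, le_max_iff, le_min_iff]
  constructor
  · rintro ⟨h1, h2 | h2⟩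
    · exact absurd h1 h2.not_gt
    · exact ⟨⟨this.trans_lt h1, h2.1⟩, h1, h2.2⟩
  · rintro ⟨⟨-, h1⟩, h2, h3⟩
    exact ⟨h2, Or.inr ⟨h1, h3⟩⟩

theorem IsSystem.const_smul {μ : 𝕜} {w : ℝ → Fin 2 → 𝕜} (h : IsSystem R T μ w) (c : 𝕜) :
    IsSystem R T μ fun t => c • w t := by
  have h0 : IsSystem R T μ fun _ => (0 : Fin 2 → 𝕜) :=
    ⟨by simpa using HasDensity.const (T := T) (0 : 𝕜), by simpa using HasDensity.const (T := T) (0 : 𝕜)⟩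
  simpa using h0.sub_smul h (-c)

theorem IsSystem.tau_clamp (hR : Admissible R T) {μ : 𝕜} {w : ℝ → Fin 2 → 𝕜}
    (hw : IsSystem R T μ w) {s t : ℝ} (hs : s ∈ dom T) (ht : t ∈ dom T) (hst : s ≤ t) :
    tau R (fun x => w (max s (min x t))) =ᵐ[vol T] fun x => μ • (Set.Ioc s t).indicator w x := by
  filter_upwards [hR.ae_posDef, (hw.hasDensity.clamp hs ht hst).hasDerivAt] with x h1 h2
  refine (tau_eq_iff h1 h2).2 ?_
  by_cases hx : x ∈ Set.Ioc s t
  · rw [Set.indicator_of_mem hx, Set.indicator_of_mem hx]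
    constructor <;>
    · simp only [Matrix.cons_val_zero, Matrix.cons_val_one, Pi.smul_apply, smul_eq_mul]
      ring
  · rw [Set.indicator_of_notMem hx, Set.indicator_of_notMem hx]
    simp

theorem quad_indicator (s : Set ℝ) (w : ℝ → Fin 2 → 𝕜) :
    (fun x => quad (R x) (s.indicator w x)) = s.indicator fun x => quad (R x) (w x) := by
  funext x
  by_cases hx : x ∈ s
  · simp [hx]
  · simp [hx, quad]

theorem LimitPoint.exists_testFunction (hLP : LimitPoint R T) (hR : Admissible R T)
    {φ₁ : ℝ} (hu₁ : u₁ ≠ 0) (hp₁ : Parallel u₁ (angleVec φ₁)) (hmem : ConstMemL2 R T u₁)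
    {μ : 𝕜} (hμ : μ ≠ 0) {v : ℝ → Fin 2 → 𝕜} (hv : IsSystem R T μ v)
    (hne : ∀ x ∈ dom T, v x ≠ 0) {s t : ℝ} (hs : s ∈ dom T) (ht : t ∈ dom T) (hst : s < t)
    (hvs : wronskian (v s) u₀ = 0) (hvt : wronskian (v t) u₁ = 0) :
    ∃ w V : ℝ → Fin 2 → 𝕜, MemL2 R T w ∧ (∀ x ∉ Set.Ioc s t, w x = 0) ∧
      innerL2 R T w w = 1 ∧ MemDomain R T u₀ u₁ V ∧ tau R V =ᵐ[vol T] w ∧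
      (‖μ‖ ^ 2)⁻¹ ≤ RCLike.re (innerL2 R T V V) := by
  have hsub : Set.Ioc s t ⊆ dom T := fun x hx => Icc_subset_dom hs.1 ht ⟨hx.1.le, hx.2⟩
  have hvol : (vol T).restrict (Set.Ioc s t) = volume.restrict (Set.Ioc s t) := by
    rw [vol, Measure.restrict_restrict measurableSet_Ioc, Set.inter_eq_left.2 hsub]
  have hmeasv := hv.continuousOn.aestronglyMeasurable (μ := volume) measurableSet_dom
  have hqv : IntervalIntegrable (fun x => quad (R x) (v x)) volume s t :=
    (hR.intervalIntegrable_quad hv.continuousOn hs).symm.trans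
      (hR.intervalIntegrable_quad hv.continuousOn ht)
  set N := ∫ x in s..t, quad (R x) (v x) with hN
  have hNpos : 0 < N := intervalIntegral.intervalIntegral_pos_of_pos_on hqv
    (fun x hx => quad_pos (hR.posDef x (hsub ⟨hx.1, hx.2.le⟩)) (hne x (hsub ⟨hx.1, hx.2.le⟩))) hst
  have hindL2 : MemL2 R T ((Set.Ioc s t).indicator v) := by
    rw [memL2_iff hR, quad_indicator, integrable_indicator_iff measurableSet_Ioc, IntegrableOn, hvol]
    exact ⟨hmeasv.indicator measurableSet_Ioc, hqv.1⟩
  have hindN : ∫ x, quad (R x) ((Set.Ioc s t).indicator v x) ∂(vol T) = N := by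
    rw [quad_indicator, integral_indicator measurableSet_Ioc, hvol, hN,
      intervalIntegral.integral_of_le hst.le]
  have hclamp : ∀ x, max s (min x t) ∈ Set.Icc s t := fun x =>
    ⟨le_max_left _ _, max_le hst.le (min_le_right _ _)⟩
  have hVcont : Continuous fun x => v (max s (min x t)) := by
    refine hv.continuousOn.comp_continuous (by fun_prop) fun x => ?_
    exact Icc_subset_dom hs.1 ht (hclamp x)
  obtain ⟨d, hd⟩ := exists_eq_smul_angleVec ((wronskian_eq_zero_iff hu₁ hp₁ _).1 hvt)
  obtain ⟨e, he, hue⟩ := exists_angleVec_of_parallel hu₁ hp₁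
  have hmem' : Integrable (fun x => quad (R x) (angleVec φ₁)) (vol T) := by
    refine (((constMemL2_iff hR u₁).1 hmem).const_mul ((e ^ 2)⁻¹)).congr
      (Eventually.of_forall fun x => ?_)
    simp only [hue, quad_smul, Real.norm_eq_abs, sq_abs]
    field_simp
  have hVL2 : MemL2 R T fun x => v (max s (min x t)) := by
    rw [memL2_iff hR]
    have hm : AEStronglyMeasurable (fun x => v (max s (min x t))) (vol T) :=
      hVcont.aestronglyMeasurable
    refine ⟨hm, integrable_vol_of_tail ht (hR.aestronglyMeasurable_quad hm)
      (hR.intervalIntegrable_quad hVcont.continuousOn ht) (hmem'.const_mul (‖d‖ ^ 2))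
      fun x hx htx => ?_⟩
    rw [abs_of_nonneg (quad_nonneg (hR.posDef x hx) _), min_eq_right htx.le, max_eq_right hst.le, hd,
      quad_smul, quad_ofReal]
  have hle : N ≤ ∫ x, quad (R x) (v (max s (min x t))) ∂(vol T) := by
    rw [← hindN]
    refine integral_mono_ae ((memL2_iff hR).1 hindL2).2 ((memL2_iff hR).1 hVL2).2 ?_
    filter_upwards [hR.ae_posDef] with x hx
    by_cases hxs : x ∈ Set.Ioc s t
    · simp only [Set.indicator_of_mem hxs, min_eq_left hxs.2, max_eq_right hxs.1.le]
      exact le_rfl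
    · simp only [Set.indicator_of_notMem hxs]
      exact (by simp [quad] : quad (R x) (0 : Fin 2 → 𝕜) = 0).trans_le (quad_nonneg hx _)
  have hμ' : 0 < ‖μ‖ := norm_pos_iff.2 hμ
  let c : 𝕜 := ((‖μ‖ * Real.sqrt N)⁻¹ : ℝ)
  have hc : ‖c‖ ^ 2 * N = (‖μ‖ ^ 2)⁻¹ := by
    simp only [c, RCLike.norm_ofReal, sq_abs, inv_pow, mul_pow, Real.sq_sqrt hNpos.le]
    field_simp
  have hcv := hv.const_smul c
  have htau := hcv.tau_clamp hR hs ht hst.le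
  have hw : (fun x => μ • (Set.Ioc s t).indicator (fun x => c • v x) x) =
      fun x => (μ * c) • (Set.Ioc s t).indicator v x := by
    funext x
    by_cases hx : x ∈ Set.Ioc s t
    · simp [hx, smul_smul]
    · simp [hx]
  rw [hw] at htau
  have hwL2 := hindL2.const_smul hR (μ * c)
  refine ⟨fun x => (μ * c) • (Set.Ioc s t).indicator v x, fun x => c • v (max s (min x t)), hwL2,
    fun x hx => by simp [hx], ?_, ⟨hVL2.const_smul hR c, ?_, hwL2.congr hR htau.symm, ?_,
    fun h => absurd h hLP⟩, htau, ?_⟩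
  · rw [innerL2_self hR]
    simp only [quad_smul]
    rw [integral_const_mul, hindN, norm_mul, mul_pow, mul_assoc, hc,
      mul_inv_cancel₀ (by positivity), RCLike.ofReal_one]
  · exact isAC_iff.2 ⟨_, hcv.hasDensity.clamp hs ht hst.le⟩
  · rw [wronskian_smul, min_eq_left ht.1, max_eq_left hs.1, hvs, mul_zero]
  · rw [innerL2_self hR, RCLike.ofReal_re]
    simp only [quad_smul]
    rw [integral_const_mul, ← hc]
    exact mul_le_mul_of_nonneg_left hle (by positivity)

theorem LimitPoint.phase_bounded (hLP : LimitPoint R T) (hT : 0 < T) (hR : Admissible R T)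
    {φ₀ φ₁ : ℝ} (hφ₀ : φ₀ ∈ Set.Ico 0 (2 * Real.pi)) (hφ₁ : φ₁ ∈ Set.Ico 0 (2 * Real.pi))
    (hu₀ : u₀ ≠ 0) (hu₁ : u₁ ≠ 0) (hp₀ : Parallel u₀ (angleVec φ₀))
    (hp₁ : Parallel u₁ (angleVec φ₁)) (hmem : ConstMemL2 R T u₁)
    (hHS : HasHilbertSchmidtInverse 𝕜 R T u₀ u₁) {lam : ℝ} (hlam : lam ≠ 0) {φ r : ℝ → ℝ}
    (hφ : HasDensity T φ fun t => 2 * lam * angleEnergy (R t) (φ t)) (hφ0 : φ 0 = φ₀)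
    {v : ℝ → Fin 2 → ℝ} (hv : IsSystem R T lam v)
    (hr : ∀ t ∈ dom T, 0 < r t ∧ v t = r t • angleVec (φ t)) :
    ∃ C, ∀ t ∈ dom T, |φ t| ≤ C := by
  have hvK : IsSystem R T (lam : 𝕜) fun t i => (v t i : 𝕜) := hv.ofReal
  have hne : ∀ x ∈ dom T, (fun i => (v x i : 𝕜)) ≠ 0 := fun x hx h0 => by
    have h1 : v x = 0 := funext fun i => by simpa using congrFun h0 i
    rw [(hr x hx).2, smul_eq_zero] at h1
    exact h1.elim (hr x hx).1.ne' (angleVec_ne_zero _)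
  have hW : ∀ u : Fin 2 → ℝ, u ≠ 0 → ∀ y, Parallel u (angleVec y) → ∀ x ∈ dom T,
      (∃ k : ℤ, φ x = y + 2 * Real.pi * k) → wronskian (fun i => (v x i : 𝕜)) u = 0 := by
    intro u hu y hp x hx hk
    rw [wronskian_ofReal, (hr x hx).2, wronskian_smul,
      (wronskian_eq_zero_iff hu hp _).2 (wronskian_angleVec_eq_zero_iff.2 hk)]
    simp
  obtain ⟨σ, hσ, hσlam⟩ : ∃ σ : ℤ, (σ = 1 ∨ σ = -1) ∧ 0 < σ * lam := by
    rcases hlam.lt_or_gt with h | h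
    · exact ⟨-1, Or.inr rfl, by push_cast; linarith⟩
    · exact ⟨1, Or.inl rfl, by push_cast; linarith⟩
  have hσ2 : (σ : ℝ) * σ = 1 := by rcases hσ with rfl | rfl <;> norm_num
  have hσabs : |(σ : ℝ)| = 1 := by rcases hσ with rfl | rfl <;> norm_num
  have hgd := hφ.const_mul (σ : ℝ)
  set g : ℝ → ℝ := fun t => σ * φ t with hg
  have hmono : MonotoneOn g (dom T) := hgd.monotoneOn fun t ht => by
    have := mul_nonneg hσlam.le (angleEnergy_pos (hR.posDef t ht) (φ t)).le
    linarith
  by_contra hcon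
  push Not at hcon
  have hunb : ∀ M, ∃ t ∈ dom T, M < g t := fun M => by
    obtain ⟨t, ht, h⟩ := hcon (max M |φ 0|)
    refine ⟨t, ht, ?_⟩
    have h1 : |g t| = |φ t| := by simp only [hg]; rw [abs_mul, hσabs, one_mul]
    have h2 : |g 0| = |φ 0| := by simp only [hg]; rw [abs_mul, hσabs, one_mul]
    have h3 := hmono (zero_mem_dom hT) ht ht.1
    rw [← h1, ← h2] at h
    rcases abs_cases (g t) with h4 | h4
    · rw [h4.1] at h
      exact (le_max_left _ _).trans_lt h
    · have h5 := neg_abs_le (g 0)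
      have h6 := (le_max_right M |g 0|).trans_lt h
      rw [h4.1] at h6
      linarith
  have hivt : ∀ y, g 0 ≤ y → ∃ t ∈ dom T, g t = y := fun y hy => by
    obtain ⟨t, ht, hyt⟩ := hunb y
    obtain ⟨x, hx, hxy⟩ := intermediate_value_Icc ht.1
      (hgd.continuousOn.mono (Icc_subset_dom le_rfl ht)) ⟨hy, hyt.le⟩
    exact ⟨x, Icc_subset_dom le_rfl ht hx, hxy⟩
  have hpi := Real.pi_pos
  have hdiff : |(σ : ℝ) * φ₁ - σ * φ₀| < 2 * Real.pi := by
    rw [← mul_sub, abs_mul, hσabs, one_mul, abs_lt]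
    constructor <;> linarith [hφ₀.1, hφ₀.2, hφ₁.1, hφ₁.2]
  rw [abs_lt] at hdiff
  have hg0 : g 0 = σ * φ₀ := by simp only [hg, hφ0]
  have hk0 : ∀ k : ℕ, 0 ≤ 4 * Real.pi * k := fun k => by positivity
  choose s hs hgs using fun k : ℕ => hivt (σ * φ₀ + 4 * Real.pi * k) (by linarith [hk0 k])
  choose t ht hgt using fun k : ℕ => hivt (σ * φ₁ + 4 * Real.pi * k + 2 * Real.pi)
    (by linarith [hk0 k, hdiff.1])
  have hlt : ∀ x ∈ dom T, ∀ y ∈ dom T, g x < g y → x < y := fun x hx y hy h => by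
    by_contra hxy
    exact (hmono hy hx (not_lt.1 hxy)).not_gt h
  have hst : ∀ k, s k < t k := fun k => hlt _ (hs k) _ (ht k) (by
    rw [hgs, hgt]; linarith [hdiff.1])
  have hts : ∀ j k, j < k → t j < s k := fun j k hjk => hlt _ (ht j) _ (hs k) (by
    rw [hgs, hgt]
    have : (j : ℝ) + 1 ≤ k := by exact_mod_cast hjk
    have := mul_le_mul_of_nonneg_left this (by positivity : 0 ≤ 4 * Real.pi)
    linarith [hdiff.2])
  have hφσ : ∀ x, φ x = σ * g x := fun x => by simp only [hg]; rw [← mul_assoc, hσ2, one_mul]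
  have htest := fun k => hLP.exists_testFunction (u₀ := u₀) hR hu₁ hp₁ hmem
    (RCLike.ofReal_ne_zero.2 hlam) hvK hne (hs k) (ht k) (hst k)
    (hW u₀ hu₀ φ₀ hp₀ _ (hs k) ⟨2 * σ * k, by
      rw [hφσ, hgs]; push_cast; linear_combination φ₀ * hσ2⟩)
    (hW u₁ hu₁ φ₁ hp₁ _ (ht k) ⟨2 * σ * k + σ, by
      rw [hφσ, hgt]; push_cast; linear_combination φ₁ * hσ2⟩)
  choose w V hw hwsupp hww hV htau hle using htest
  obtain ⟨-, C, hC⟩ := hHS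
  obtain ⟨n, hn⟩ := exists_nat_gt (C * ‖(lam : 𝕜)‖ ^ 2)
  have hlamK : 0 < ‖(lam : 𝕜)‖ := norm_pos_iff.2 (RCLike.ofReal_ne_zero.2 hlam)
  have hsum := hC n (fun k => w k) (fun k => V k) (fun k => hw k) (fun k l => ?_)
    (fun k => ⟨hV k, htau k⟩)
  · have h1 := Finset.card_nsmul_le_sum (Finset.univ : Finset (Fin n))
      (fun k : Fin n => RCLike.re (innerL2 R T (V k) (V k))) _ (fun k _ => hle k)
    rw [Finset.card_univ, Fintype.card_fin, nsmul_eq_mul] at h1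
    have h2 := h1.trans hsum
    rw [← div_eq_mul_inv, div_le_iff₀ (by positivity)] at h2
    linarith
  · split_ifs with hkl
    · rw [hkl]; exact hww l
    · have hkl' : (k : ℕ) ≠ l := fun h => hkl (Fin.ext h)
      rw [innerL2]
      refine integral_eq_zero_of_ae (Eventually.of_forall fun x => ?_)
      have hdisj : w k x = 0 ∨ w l x = 0 := by
        by_contra hcon2
        push Not at hcon2
        have h1 : x ∈ Set.Ioc (s k) (t k) := by_contra fun h => hcon2.1 (hwsupp k x h)
        have h2 : x ∈ Set.Ioc (s l) (t l) := by_contra fun h => hcon2.2 (hwsupp l x h)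
        rcases hkl'.lt_or_gt with h | h
        · exact absurd (h1.2.trans_lt (hts _ _ h)) h2.1.not_gt
        · exact absurd (h2.2.trans_lt (hts _ _ h)) h1.1.not_gt
      rcases hdisj with h | h <;> simp [pairing, h]

end TestFunction

section LimitDirection

variable {R : ℝ → Matrix (Fin 2) (Fin 2) ℝ} {T : EReal} {u₁ : Fin 2 → ℝ}

theorem quad_real (A : Matrix (Fin 2) (Fin 2) ℝ) (x : Fin 2 → ℝ) :
    quad A x = A 0 0 * x 0 ^ 2 + 2 * A 0 1 * (x 0 * x 1) + A 1 1 * x 1 ^ 2 := by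
  simp [quad]

theorem quad_add_le {A : Matrix (Fin 2) (Fin 2) ℝ} (hA : A.PosDef) (x y : Fin 2 → ℝ) :
    quad A (x + y) ≤ 2 * quad A x + 2 * quad A y := by
  have h := quad_nonneg hA (x - y)
  simp only [quad_real, Pi.add_apply, Pi.sub_apply] at h ⊢
  linarith

theorem abs_apply_zero_one_le {A : Matrix (Fin 2) (Fin 2) ℝ} (hA : A.PosDef) :
    |A 0 1| ≤ A 0 0 + A 1 1 := by
  have h1 := quad_nonneg hA ![(1 : ℝ), 1]
  have h2 := quad_nonneg hA ![(1 : ℝ), -1]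
  have h3 : 0 < A 0 0 := hA.diag_pos
  have h4 : 0 < A 1 1 := hA.diag_pos
  simp [quad_real] at h1 h2
  rw [abs_le]
  constructor <;> linarith

theorem sq_wronskian_mul_quad_le {A : Matrix (Fin 2) (Fin 2) ℝ} (hA : A.PosDef)
    (e u x : Fin 2 → ℝ) :
    wronskian e u ^ 2 * quad A x ≤
      2 * wronskian x u ^ 2 * quad A e + 2 * wronskian e x ^ 2 * quad A u := by
  have h := quad_add_le hA (wronskian x u • e) (wronskian e x • u)
  have hx : wronskian x u • e + wronskian e x • u = wronskian e u • x := by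
    refine funext (Fin.forall_fin_two.2 ⟨?_, ?_⟩) <;>
    · simp [wronskian_eq]
      ring
  rw [hx] at h
  simp only [quad_smul, Real.norm_eq_abs, sq_abs] at h
  linarith

theorem abs_wronskian_angleVec_le (y : ℝ) (x : Fin 2 → ℝ) :
    |wronskian (angleVec y) x| ≤ |x 0| + |x 1| := by
  rw [wronskian_eq]
  have h0 : |angleVec y 0| ≤ 1 := by simpa [angleVec] using Real.abs_cos_le_one _
  have h1 : |angleVec y 1| ≤ 1 := by simpa [angleVec] using Real.abs_sin_le_one _
  refine (abs_sub _ _).trans ?_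
  simp only [RCLike.ofReal_real_eq_id, id, abs_mul]
  have := mul_le_mul_of_nonneg_right h0 (abs_nonneg (x 1))
  have := mul_le_mul_of_nonneg_right h1 (abs_nonneg (x 0))
  linarith

theorem limitCircle_of_integrable_diag (hR : Admissible R T)
    (h0 : Integrable (fun t => R t 0 0) (vol T)) (h1 : Integrable (fun t => R t 1 1) (vol T)) :
    LimitCircle R T := by
  have h01 : Integrable (fun t => R t 0 1) (vol T) := by
    refine Integrable.mono' (h0.add h1) (hR.measurable 0 1) ?_
    filter_upwards [hR.ae_posDef] with t ht using abs_apply_zero_one_le ht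
  have h10 : Integrable (fun t => R t 1 0) (vol T) := by
    refine h01.congr ?_
    filter_upwards [hR.ae_posDef] with t ht using ht.apply_one_zero.symm
  exact Fin.forall_fin_two.2 ⟨Fin.forall_fin_two.2 ⟨h0, h01⟩, Fin.forall_fin_two.2 ⟨h10, h1⟩⟩

theorem LimitPoint.wronskian_limit_eq_zero (hLP : LimitPoint R T) (hT : 0 < T)
    (hR : Admissible R T) (hmem : ConstMemL2 R T u₁) {lam : ℝ} (hlam : lam ≠ 0) {φ : ℝ → ℝ}
    (hφ : HasDensity T φ fun t => 2 * lam * angleEnergy (R t) (φ t)) {C : ℝ}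
    (hC : ∀ t ∈ dom T, |φ t| ≤ C) {L : ℝ} (hL : Tendsto φ (leftOf T) (𝓝 L)) :
    wronskian (angleVec L) u₁ = 0 := by
  by_contra hne
  refine hLP ?_
  have hint : Integrable (fun t => angleEnergy (R t) (φ t)) (vol T) := by
    refine integrable_vol_of_bounded hT (fun t ht => (angleEnergy_pos (hR.posDef t ht) _).le)
      (fun t ht => hR.intervalIntegrable_angleEnergy hφ.continuousOn ht)
      (C := 2 * C / |2 * lam|) fun t ht => ?_
    have h1 := hφ.2 t ht
    rw [intervalIntegral.integral_const_mul] at h1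
    rw [le_div_iff₀ (by positivity)]
    have h2 : |2 * lam * ∫ s in (0 : ℝ)..t, angleEnergy (R s) (φ s)| ≤ 2 * C := by
      rw [← sub_eq_iff_eq_add'.2 h1]
      exact (abs_sub _ _).trans (by linarith [hC t ht, hC 0 (zero_mem_dom hT)])
    rw [abs_mul, mul_comm] at h2
    exact (mul_le_mul_of_nonneg_right (le_abs_self _) (abs_nonneg _)).trans h2
  have hmem' := (constMemL2_iff hR u₁).1 hmem
  have hlim := ((continuous_wronskian_angleVec u₁).tendsto L).comp hL
  have hpos : 0 < |wronskian (angleVec L) u₁| := abs_pos.2 hne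
  obtain ⟨b, hb, hbt⟩ := exists_of_eventually_leftOf hT
    (hlim.abs.eventually (lt_mem_nhds (half_lt_self hpos)))
  set δ := |wronskian (angleVec L) u₁| / 2
  have hδ : 0 < δ := half_pos hpos
  have key : ∀ x : Fin 2 → ℝ, Integrable (fun t => quad (R t) x) (vol T) := fun x => by
    refine integrable_vol_of_tail hb
      (hR.aestronglyMeasurable_quad (w := fun _ => x) aestronglyMeasurable_const)
      (hR.intervalIntegrable_quad (w := fun _ => x) continuousOn_const hb)
      (((hint.const_mul (2 * wronskian x u₁ ^ 2)).add
        (hmem'.const_mul (2 * (|x 0| + |x 1|) ^ 2))).div_const (δ ^ 2)) fun t ht hlt => ?_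
    rw [abs_of_nonneg (quad_nonneg (hR.posDef t ht) _), le_div_iff₀ (by positivity)]
    have h1 := sq_wronskian_mul_quad_le (hR.posDef t ht) (angleVec (φ t)) u₁ x
    have h2 : δ ^ 2 ≤ wronskian (angleVec (φ t)) u₁ ^ 2 := by
      rw [← sq_abs (wronskian _ _)]
      have : δ < |wronskian (angleVec (φ t)) u₁| := hbt t ht hlt
      gcongr
    have h3 : wronskian (angleVec (φ t)) x ^ 2 ≤ (|x 0| + |x 1|) ^ 2 := by
      rw [← sq_abs (wronskian _ _)]
      have := abs_wronskian_angleVec_le (φ t) x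
      gcongr
    have h4 := mul_le_mul_of_nonneg_right h2 (quad_nonneg (hR.posDef t ht) x)
    have h5 := mul_le_mul_of_nonneg_right h3 (quad_nonneg (hR.posDef t ht) u₁)
    simp only [Pi.add_apply, angleEnergy]
    linarith
  refine limitCircle_of_integrable_diag hR ?_ ?_
  · simpa [quad_real] using key ![1, 0]
  · simpa [quad_real] using key ![0, 1]

end LimitDirection

end Dirac

theorem mainTheorem5 (𝕜 : Type*) [RCLike 𝕜]
    (T : EReal) (hT : 0 < T)
    (z : ℝ → UpperHalfPlane) (f : ℝ → ℝ) (hf : ∀ t ∈ Dirac.dom T, 0 < f t)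
    (hR : Dirac.Admissible (Dirac.weight z f) T)
    (u₀ u₁ : Fin 2 → ℝ) (hu : ¬ Dirac.Parallel u₀ u₁)
    (hLP : Dirac.LimitPoint (Dirac.weight z f) T → Dirac.ConstMemL2 (Dirac.weight z f) T u₁)
    (hHS : Dirac.HasHilbertSchmidtInverse 𝕜 (Dirac.weight z f) T u₀ u₁)
    (φ₀ φ₁ : ℝ) (hφ₀ : φ₀ ∈ Set.Ico 0 (2 * Real.pi)) (hφ₁ : φ₁ ∈ Set.Ico 0 (2 * Real.pi))
    (hu₀ : Dirac.Parallel u₀ (Dirac.angleVec φ₀)) (hu₁ : Dirac.Parallel u₁ (Dirac.angleVec φ₁))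
    (φ : ℝ → ℝ → ℝ)
    (hφ : ∀ lam : ℝ, Dirac.IsPhaseFunction (Dirac.weight z f) T φ₀ lam (φ lam)) :
    ∃ Φ : ℝ → ℝ,
      (∀ lam : ℝ, Tendsto (φ lam) (Dirac.leftOf T) (𝓝 (Φ lam))) ∧
      (Dirac.LimitCircle (Dirac.weight z f) T →
        Continuous Φ ∧ StrictMono Φ ∧
        {μ : 𝕜 | Dirac.IsEigenvalue (Dirac.weight z f) T u₀ u₁ μ} =
          (fun lam : ℝ => (lam : 𝕜)) ''
            {lam : ℝ | ∃ k : ℤ, Φ lam = φ₁ + 2 * Real.pi * k}) ∧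
      (Dirac.LimitPoint (Dirac.weight z f) T →
        ∀ lam : ℝ, lam ≠ 0 → ∃ k : ℤ, Φ lam = φ₁ + 2 * Real.pi * k) := by
  have hne₀ : u₀ ≠ 0 := fun h => hu (by simp [h, Dirac.Parallel])
  have hne₁ : u₁ ≠ 0 := fun h => hu (by simp [h, Dirac.Parallel])
  have hd : ∀ lam, _ := fun lam => ((hφ lam).exists_solution hT hR).1
  have hbdd : Dirac.LimitPoint (Dirac.weight z f) T → ∀ lam : ℝ, lam ≠ 0 →
      ∃ C, ∀ t ∈ Dirac.dom T, |φ lam t| ≤ C := fun h lam hlam => by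
    obtain ⟨hdens, v, r, hv, -, hr⟩ := (hφ lam).exists_solution hT hR
    exact h.phase_bounded hT hR hφ₀ hφ₁ hne₀ hne₁ hu₀ hu₁ (hLP h) hHS hlam hdens (hφ lam).2.1 hv hr
  have hlim : ∀ lam, ∃ L, Tendsto (φ lam) (Dirac.leftOf T) (𝓝 L) := fun lam => by
    by_cases h : Dirac.LimitCircle (Dirac.weight z f) T
    · exact h.exists_tendsto_phase hT hR (hd lam)
    · rcases eq_or_ne lam 0 with rfl | hlam
      · refine Dirac.exists_tendsto_of_bounded hT hR (hd 0) (C := |φ 0 0|) fun t ht => ?_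
        rw [(hd 0).eq_of_ae_zero (Eventually.of_forall fun t => by simp) ht]
      · obtain ⟨C, hC⟩ := hbdd h lam hlam
        exact Dirac.exists_tendsto_of_bounded hT hR (hd lam) hC
  choose Φ hΦ using hlim
  refine ⟨Φ, hΦ, fun hLC => ?_, fun h lam hlam => ?_⟩
  · obtain ⟨h1, h2⟩ := hLC.continuous_and_strictMono hT hR hd
      (fun lam μ => by rw [(hφ lam).2.1, (hφ μ).2.1]) hΦ
    have hiff : ∀ lam : ℝ, Dirac.IsEigenvalue (Dirac.weight z f) T u₀ u₁ (lam : 𝕜) ↔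
        ∃ k : ℤ, Φ lam = φ₁ + 2 * Real.pi * k := fun lam => by
      obtain ⟨-, v, r, hv, hv0, hr⟩ := (hφ lam).exists_solution hT hR
      exact hLC.isEigenvalue_iff hT hR hne₀ hne₁ hu₀ hu₁ hv hv0 hr (hΦ lam)
    refine ⟨h1, h2, Set.ext fun μ => ⟨fun hμ => ?_, ?_⟩⟩
    · obtain ⟨lam, rfl⟩ := Dirac.IsEigenvalue.exists_real hLC hT hR hne₀ hne₁ hμ
      exact ⟨lam, (hiff lam).1 hμ, rfl⟩
    · rintro ⟨lam, hk, rfl⟩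
      exact (hiff lam).2 hk
  · obtain ⟨C, hC⟩ := hbdd h lam hlam
    have := h.wronskian_limit_eq_zero hT hR (hLP h) hlam (hd lam) hC (hΦ lam)
    rwa [Dirac.wronskian_eq_zero_iff hne₁ hu₁, Dirac.wronskian_angleVec_eq_zero_iff] at this
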